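/- Let $(A,\mathfrak m)$ be a Gorenstein local ring (that is, a commutative Noetherian local ring of finite injective dimension as a module over itself) of dimension $d=\dim A>0$, and let $Q=(a_1,\dots,a_d)$ be a parameter ideal in $A$, that is, an ideal generated by a system of parameters $a_1,\dots,a_d$ of $A$. Put $I=Q:\mathfrak m^2$. Let $\mathrm e^0_{\mathfrak m}(A)=\lim_{n\to\infty} \frac{d!\,\ell_A(A/\mathfrak m^n)}{n^d}$ be the multiplicity of $A$ with respect to $\mathfrak m$, where $\ell_A$ denotes length, and let $\mathrm v(A/Q)=\ell_{A/Q}(\mathfrak n/\mathfrak n^2)$ be the embedding dimension of the local ring $A/Q$, where $\mathfrak n=\mathfrak m/Q$ is its maximal ideal. Suppose that $\mathrm e^0_{\mathfrak m}(A)\ge 3$ and $\mathrm v(A/Q)>1$. Then $I$ is integral over $Q$, that is, every $x\in I$ satisfies an equation $x^n+c_1x^{n-1}+\dots+c_n=0$ with $n\ge 1$ and $c_i\in Q^i$ for $1\le i\le n$. -/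

import Mathlib

open Filter CategoryTheory
open scoped ENNReal Nat

noncomputable section

/-- A Gorenstein local ring: a commutative Noetherian local ring which has finite injective
dimension as a module over itself. -/
class IsGorensteinLocalRing (A : Type*) [CommRing A] : Prop extends
    IsLocalRing A, IsNoetherianRing A where
  finite_injectiveDimension : ∃ n : ℕ, HasInjectiveDimensionLE (ModuleCat.of A A) n

/-- A parameter ideal of a local ring `A` of dimension `d`: an ideal generated by a system of
parameters, that is, by `d` elements which generate an ideal whose radical is the maximal ideal. -/
def IsParameterIdeal {A : Type*} [CommRing A] [IsLocalRing A] (Q : Ideal A) : Prop :=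
  ∃ (d : ℕ) (a : Fin d → A), ringKrullDim A = (d : WithBot ℕ∞) ∧
    Q = Ideal.span (Set.range a) ∧ Q.radical = IsLocalRing.maximalIdeal A

theorem IsParameterIdeal.isLocalRing_quotient {A : Type*} [CommRing A] [IsLocalRing A]
    {Q : Ideal A} (hQ : IsParameterIdeal Q) : IsLocalRing (A ⧸ Q) := by
  obtain ⟨d, a, -, -, h⟩ := hQ
  have hne : Q ≠ ⊤ := by
    rintro rfl
    rw [Ideal.radical_top] at h
    exact (IsLocalRing.maximalIdeal.isMaximal A).ne_top h.symm
  have : Nontrivial (A ⧸ Q) := Ideal.Quotient.nontrivial_iff.mpr hne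
  exact IsLocalRing.of_surjective' (Ideal.Quotient.mk Q) Ideal.Quotient.mk_surjective

/-- The embedding dimension of a local ring `R` with maximal ideal `𝔫`: the length of the
`R`-module `𝔫 / 𝔫 ^ 2`. -/
def embeddingDimension (R : Type*) [CommRing R] [IsLocalRing R] : ℕ∞ :=
  Module.length R (IsLocalRing.CotangentSpace R)

/-- The Krull dimension of a ring as a natural number (for rings of finite Krull dimension). -/
def krullDimNat (A : Type*) [CommRing A] : ℕ :=
  ((ringKrullDim A).unbotD 0).toNat

/-- The (Hilbert-Samuel) multiplicity of a local ring `A` of dimension `d` with respect to its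
maximal ideal `𝔪`, as an extended nonnegative real number: the limit of the sequence
`d! * length (A / 𝔪 ^ n) / n ^ d`. For a Noetherian local ring this limit exists, so that it is
the upper limit of the sequence, which needs no proof of convergence to be written down. -/
def localMultiplicity (A : Type*) [CommRing A] [IsLocalRing A] : ℝ≥0∞ :=
  limsup (fun n : ℕ =>
    ((krullDimNat A)! : ℝ≥0∞) *
      ((Module.length A (A ⧸ IsLocalRing.maximalIdeal A ^ n) : ℕ∞) : ℝ≥0∞) /
        (n : ℝ≥0∞) ^ krullDimNat A) atTop

/-- The element `x` is integral over the ideal `Q`: it satisfies an equation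
`x ^ n + c₁ * x ^ (n - 1) + ⋯ + cₙ = 0` with `n ≥ 1` and `cᵢ ∈ Q ^ i` for all `i`. -/
def IsIntegralOverIdeal {A : Type*} [CommRing A] (Q : Ideal A) (x : A) : Prop :=
  ∃ (n : ℕ) (c : ℕ → A), 1 ≤ n ∧ (∀ i ∈ Finset.Icc 1 n, c i ∈ Q ^ i) ∧
    x ^ n + ∑ i ∈ Finset.Icc 1 n, c i * x ^ (n - i) = 0

end

/-! It suffices to show 𝔪²I ⊆ 𝔪²Q. Since dim A > 0, the ideal 𝔪² contains a nonzerodivisor, and the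
determinant trick on 𝔪² (`IsIntegralOverIdeal.of_forall_mul_mem`) then makes every x ∈ I integral
over Q.

The multiplicity enters through socles. For every parameter ideal Q', e(A) ≤ ℓ(A/Q') and A/Q' has
simple socle. If that socle is not inside 𝔪² + Q', then 𝔪² ⊆ Q', so 𝔪/Q' is the socle and ℓ(A/Q') ≤
2. Hence e(A) ≥ 3 puts the socle of A/Q' inside the square of the maximal ideal, for all Q' at once
(`mem_sq_sup_of_mul_mem`).

In dimension one, let s generate the socle modulo a parameter a. Multiplication by s/a maps 𝔪 to 𝔪
and sends a regular z to a socle element modulo z, hence into 𝔪² + (z). So every vector of 𝔪/𝔪² is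
an eigenvector, the induced map is a scalar, and correcting s by a multiple of a gives s𝔪 ⊆ a𝔪².
From this 𝔪²((a) : 𝔪²) ⊆ a𝔪² follows (`exists_mem_sq_mul_eq_mul`).

In general this is applied modulo all parameters but one. As each parameter is regular modulo the
others, 𝔪²I lies in 𝔪²Q plus the span of the b_i b_j with i < j (`mem_sq_mul_sup_of_forall`). Choose
b with as many members as possible in 𝔪². If neither b_i nor b_j is in 𝔪², comparison with the
system having b_j - b_i in place of b_j forces the coefficient of b_i b_j into 𝔪
(`coeff_mem_maximalIdeal`); in all cases the term lies in 𝔪²Q.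

The Gorenstein facts needed (regular quotients, unmixedness, simple socles) are derived directly
from finite injective dimension. -/

noncomputable section

universe u

/-! ### The functor of elements killed by x. -/

namespace Submodule

variable {R : Type u} [CommRing R] {M N P : Type u} [AddCommGroup M] [Module R M]
  [AddCommGroup N] [Module R N] [AddCommGroup P] [Module R P]

/-- The map induced by a linear map on the submodules of elements killed by `x`, as a linear map
over the quotient ring `R ⧸ (x)`. -/
def torsionByMap (x : R) (f : M →ₗ[R] N) :
    torsionBy R M x →ₗ[R ⧸ Ideal.span {x}] torsionBy R N x where
  toFun m := ⟨f m, by rw [mem_torsionBy_iff, ← map_smul, smul_coe_torsionBy, map_zero]⟩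
  map_add' _ _ := by ext; simp
  map_smul' r m := by
    obtain ⟨r, rfl⟩ := Ideal.Quotient.mk_surjective r
    ext
    exact f.map_smul r m

@[simp]
theorem coe_torsionByMap (x : R) (f : M →ₗ[R] N) (m : torsionBy R M x) :
    (torsionByMap x f m : N) = f m := rfl

theorem torsionByMap_injective (x : R) (f : M →ₗ[R] N) (hf : Function.Injective f) :
    Function.Injective (torsionByMap x f) := fun _ _ h ↦
  Subtype.ext (hf (congrArg Subtype.val h))

theorem torsionByMap_exact (x : R) (f : M →ₗ[R] N) (g : N →ₗ[R] P) (hf : Function.Injective f)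
    (hfg : Function.Exact f g) : Function.Exact (torsionByMap x f) (torsionByMap x g) := by
  intro n
  constructor
  · intro h
    obtain ⟨m, hm⟩ := (hfg n).1 (congrArg Subtype.val h)
    refine ⟨⟨m, ?_⟩, Subtype.ext hm⟩
    rw [mem_torsionBy_iff]
    apply hf
    rw [map_smul, hm, smul_coe_torsionBy, map_zero]
  · rintro ⟨m, rfl⟩
    exact Subtype.ext (hfg.apply_apply_eq_zero m)

/-- By the snake lemma the obstruction lies in M/xM, which vanishes when M is x-divisible. -/
theorem torsionByMap_surjective (x : R) (f : M →ₗ[R] N) (g : N →ₗ[R] P)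
    (hfg : Function.Exact f g) (hg : Function.Surjective g)
    (hM : Function.Surjective fun m : M ↦ x • m) : Function.Surjective (torsionByMap x g) := by
  rintro ⟨p, hp⟩
  obtain ⟨n, rfl⟩ := hg p
  rw [mem_torsionBy_iff, ← map_smul] at hp
  obtain ⟨m, hm⟩ := (hfg _).1 hp
  obtain ⟨m', rfl⟩ := hM m
  refine ⟨⟨n - f m', ?_⟩, Subtype.ext ?_⟩
  · rw [mem_torsionBy_iff, smul_sub, ← hm, map_smul, sub_self]
  · simp [hfg.apply_apply_eq_zero]

end Submodule

/-! ### Injective dimension and quotients by a nonzerodivisor. -/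

section InjectiveDimension

open Submodule

variable {R : Type u} [CommRing R]

/-- Extend over R: the values of the extension are killed by x because its source is. -/
theorem Module.Injective.torsionBy (x : R) (M : Type u) [AddCommGroup M] [Module R M]
    [Module.Injective R M] : Module.Injective (R ⧸ Ideal.span {x}) (torsionBy R M x) where
  out X Y _ _ _ _ f hf g := by
    let _ : Module R X := Module.compHom X (Ideal.Quotient.mk (Ideal.span {x}))
    let _ : Module R Y := Module.compHom Y (Ideal.Quotient.mk (Ideal.span {x}))
    let f' : X →ₗ[R] Y := { toFun := f, map_add' := map_add f, map_smul' := fun r a ↦ map_smul f _ a }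
    let g' : X →ₗ[R] M :=
      { toFun := fun a ↦ g a
        map_add' := fun a b ↦ by simp
        map_smul' := fun r a ↦ congrArg Subtype.val (map_smul g (Ideal.Quotient.mk _ r) a) }
    obtain ⟨h, hh⟩ := Module.Injective.extension_property R M _ _ f' hf g'
    have hx (y : Y) : x • y = 0 := by
      change (Ideal.Quotient.mk (Ideal.span {x}) x) • y = 0
      rw [Ideal.Quotient.eq_zero_iff_mem.2 (Ideal.mem_span_singleton_self x), zero_smul]
    refine ⟨
      { toFun := fun y ↦ ⟨h y, by rw [mem_torsionBy_iff, ← map_smul, hx, map_zero]⟩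
        map_add' := fun a b ↦ by ext; simp
        map_smul' := fun r a ↦ by
          obtain ⟨r, rfl⟩ := Ideal.Quotient.mk_surjective r
          ext
          exact h.map_smul r a }, fun a ↦ Subtype.ext (LinearMap.congr_fun hh a)⟩

theorem Module.Injective.smul_surjective (M : Type u) [AddCommGroup M] [Module R M]
    [Module.Injective R M] {x : R} (hx : x ∈ nonZeroDivisors R) :
    Function.Surjective fun m : M ↦ x • m := by
  intro m
  obtain ⟨h, hh⟩ := Module.Injective.extension_property R M _ _ (LinearMap.mulLeft R x)
    (fun a b hab ↦ (mul_cancel_left_mem_nonZeroDivisors hx).1 hab) (LinearMap.toSpanSingleton R M m)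
  refine ⟨h 1, ?_⟩
  have := LinearMap.congr_fun hh 1
  simpa [← map_smul] using this

/-- A module embeds into an injective module. -/
theorem Module.exists_injective_embedding (M : Type u) [AddCommGroup M] [Module R M] :
    ∃ (E : Type u) (_ : AddCommGroup E) (_ : Module R E) (f : M →ₗ[R] E),
      Module.Injective R E ∧ Function.Injective f := by
  let ⟨E, _, f, _⟩ := EnoughInjectives.presentation (ModuleCat.of R M)
  exact ⟨E, inferInstance, inferInstance, f.hom, Module.injective_module_of_injective_object R E,
    (ModuleCat.mono_iff_injective f).mp ‹_›⟩

section ShortExact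

variable {M N P : Type u} [AddCommGroup M] [Module R M]
  [AddCommGroup N] [Module R N] [AddCommGroup P] [Module R P]

/-- A short exact sequence of linear maps, as a short complex of modules. -/
abbrev moduleShortComplex (f : M →ₗ[R] N) (g : N →ₗ[R] P) (h : Function.Exact f g) :
    ShortComplex (ModuleCat.{u} R) :=
  ModuleCat.shortComplexOfCompEqZero f g h.linearMap_comp_eq_zero

theorem moduleShortComplex_shortExact (f : M →ₗ[R] N) (g : N →ₗ[R] P) (h : Function.Exact f g)
    (hf : Function.Injective f) (hg : Function.Surjective g) :
    (moduleShortComplex f g h).ShortExact :=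
  ModuleCat.shortComplex_shortExact _ h hf hg

theorem hasInjectiveDimensionLE_succ_iff (f : M →ₗ[R] N) (g : N →ₗ[R] P)
    (h : Function.Exact f g) (hf : Function.Injective f) (hg : Function.Surjective g)
    [Module.Injective R N] (n : ℕ) :
    HasInjectiveDimensionLE (ModuleCat.of R P) n ↔
      HasInjectiveDimensionLE (ModuleCat.of R M) (n + 1) :=
  (moduleShortComplex_shortExact f g h hf hg).hasInjectiveDimensionLT_X₃_iff n
    (Module.injective_object_of_injective_module R N)

theorem hasInjectiveDimensionLE_zero_iff :
    HasInjectiveDimensionLE (ModuleCat.of R M) 0 ↔ Module.Injective R M := by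
  rw [Module.injective_iff_injective_object, injective_iff_hasInjectiveDimensionLT_one]

end ShortExact

/-- On x-divisible modules, taking x-torsion is exact and turns injectives over R into injectives
over R/(x), so it transports injective resolutions. Divisibility passes to the cokernels. -/
theorem hasInjectiveDimensionLE_torsionBy {x : R} (hx : x ∈ nonZeroDivisors R) (n : ℕ) (M : Type u) [AddCommGroup M]
    [Module R M] (hM : Function.Surjective fun m : M ↦ x • m)
    (h : HasInjectiveDimensionLE (ModuleCat.of R M) n) :
    HasInjectiveDimensionLE (ModuleCat.of (R ⧸ Ideal.span {x}) (torsionBy R M x)) n := by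
  induction n generalizing M with
  | zero =>
    rw [hasInjectiveDimensionLE_zero_iff] at h ⊢
    exact Module.Injective.torsionBy x M
  | succ n ih =>
    obtain ⟨E, _, _, f, hE, hf⟩ := Module.exists_injective_embedding (R := R) M
    have := Module.Injective.torsionBy x E
    have hC : Function.Surjective fun m : E ⧸ LinearMap.range f ↦ x • m := by
      intro c
      obtain ⟨e, rfl⟩ := mkQ_surjective _ c
      obtain ⟨e', rfl⟩ := Module.Injective.smul_surjective E hx e
      exact ⟨(LinearMap.range f).mkQ e', rfl⟩
    refine (hasInjectiveDimensionLE_succ_iff (torsionByMap x f)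
      (torsionByMap x (LinearMap.range f).mkQ)
      (torsionByMap_exact x _ _ hf f.exact_map_mkQ_range) (torsionByMap_injective x f hf)
      (torsionByMap_surjective x f _ f.exact_map_mkQ_range (mkQ_surjective _) hM) n).1 (ih _ hC ?_)
    exact (hasInjectiveDimensionLE_succ_iff f _ f.exact_map_mkQ_range hf
      (mkQ_surjective _) n).2 h

/-- If `E` is an `x`-divisible module containing `R`, then the module of elements of `E ⧸ R` killed by
`x` is the direct sum of the module of elements of `E` killed by `x` and of `R ⧸ (x)`. -/
theorem nonempty_prod_linearEquiv_torsionBy_quotient_range {x : R} {E : Type u} [AddCommGroup E]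
    [Module R E] (hE : Function.Surjective fun m : E ↦ x • m) (f : R →ₗ[R] E)
    (hf : Function.Injective f) :
    Nonempty ((torsionBy R E x × (R ⧸ Ideal.span {x})) ≃ₗ[R ⧸ Ideal.span {x}]
      torsionBy R (E ⧸ LinearMap.range f) x) := by
  -- The class of e = "1/x" in E/R generates the summand R/(x).
  obtain ⟨e, he⟩ := hE (f 1)
  have hf' (r : R) : f r = r • f 1 := by rw [← map_smul, smul_eq_mul, mul_one]
  let c : torsionBy R (E ⧸ LinearMap.range f) x :=
    ⟨(LinearMap.range f).mkQ e, by
      rw [mem_torsionBy_iff, ← map_smul]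
      exact (Submodule.Quotient.mk_eq_zero _).2 ⟨1, he.symm⟩⟩
  let θ := LinearMap.coprod (torsionByMap x (LinearMap.range f).mkQ)
    (LinearMap.toSpanSingleton (R ⧸ Ideal.span {x}) _ c)
  have hθ (u : torsionBy R E x) (r : R) :
      (θ (u, Ideal.Quotient.mk _ r) : E ⧸ LinearMap.range f) =
        (LinearMap.range f).mkQ (u + r • e) := rfl
  have hinj : Function.Injective θ := by
    rw [← LinearMap.ker_eq_bot, eq_bot_iff]
    rintro ⟨u, r⟩ h0
    obtain ⟨r, rfl⟩ := Ideal.Quotient.mk_surjective r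
    have h1 := congrArg Subtype.val (LinearMap.mem_ker.1 h0)
    rw [hθ] at h1
    obtain ⟨s, hs⟩ := (Submodule.Quotient.mk_eq_zero _).1 h1
    have h2 : r = x * s := by
      apply hf
      rw [← smul_eq_mul, map_smul, hs, smul_add, smul_coe_torsionBy, zero_add, smul_comm, hf' r]
      exact congrArg _ he.symm
    subst h2
    have h3 : (u : E) = 0 := by
      have : (x * s) • e = f s := by
        rw [mul_comm, mul_smul, hf' s]
        exact congrArg _ he
      rwa [this, right_eq_add] at hs
    have h4 : Ideal.Quotient.mk (Ideal.span {x}) (x * s) = 0 :=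
      Ideal.Quotient.eq_zero_iff_mem.2 (Ideal.mul_mem_right _ _ (Ideal.mem_span_singleton_self x))
    rw [Submodule.mem_bot, h4]
    exact Prod.ext (Subtype.ext h3) rfl
  have hsurj : Function.Surjective θ := by
    rintro ⟨q, hq⟩
    obtain ⟨y, rfl⟩ := mkQ_surjective _ q
    rw [mem_torsionBy_iff, ← map_smul] at hq
    obtain ⟨r, hr⟩ := (Submodule.Quotient.mk_eq_zero _).1 hq
    refine ⟨(⟨y - r • e, ?_⟩, Ideal.Quotient.mk _ r), Subtype.ext ?_⟩
    · rw [mem_torsionBy_iff, smul_sub, ← hr, smul_comm, hf' r, sub_eq_zero]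
      exact congrArg _ he.symm
    · rw [hθ, sub_add_cancel]
  exact ⟨LinearEquiv.ofBijective θ ⟨hinj, hsurj⟩⟩

theorem hasInjectiveDimensionLE_of_prod {M N P : Type u} [AddCommGroup M] [Module R M]
    [AddCommGroup N] [Module R N] [AddCommGroup P] [Module R P] (e : (M × N) ≃ₗ[R] P) (n : ℕ)
    (h : HasInjectiveDimensionLE (ModuleCat.of R P) n) :
    HasInjectiveDimensionLE (ModuleCat.of R N) n := by
  refine Retract.hasInjectiveDimensionLT (Y := ModuleCat.of R P)
    ⟨ModuleCat.ofHom (e.toLinearMap ∘ₗ LinearMap.inr _ _ _),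
      ModuleCat.ofHom (LinearMap.snd _ _ _ ∘ₗ e.symm.toLinearMap), ?_⟩ (n + 1)
  ext
  simp

/-- If `x` is a nonzerodivisor of a ring `R` of finite injective dimension, then `R ⧸ (x)` has
finite injective dimension. -/
theorem hasInjectiveDimensionLE_quotient_span_singleton {x : R} (hx : x ∈ nonZeroDivisors R)
    (n : ℕ) (h : HasInjectiveDimensionLE (ModuleCat.of R R) n) :
    HasInjectiveDimensionLE (ModuleCat.of (R ⧸ Ideal.span {x}) (R ⧸ Ideal.span {x})) n := by
  obtain ⟨E, _, _, f, hE, hf⟩ := Module.exists_injective_embedding (R := R) R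
  have hdiv := Module.Injective.smul_surjective E hx
  have hC : Function.Surjective fun m : E ⧸ LinearMap.range f ↦ x • m := by
    intro c
    obtain ⟨e, rfl⟩ := mkQ_surjective _ c
    obtain ⟨e', rfl⟩ := hdiv e
    exact ⟨(LinearMap.range f).mkQ e', rfl⟩
  -- The bound n is first weakened to n + 1, so that the cokernel E/R gets the bound n without
  -- subtraction, also for n = 0.
  have hC' := hasInjectiveDimensionLE_torsionBy hx n _ hC <|
    (hasInjectiveDimensionLE_succ_iff f _ f.exact_map_mkQ_range hf (mkQ_surjective _) n).2 <|
      hasInjectiveDimensionLT_of_ge _ (n + 1) (n + 1 + 1) (Nat.le_succ _)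
  obtain ⟨e⟩ := nonempty_prod_linearEquiv_torsionBy_quotient_range hdiv f hf
  exact hasInjectiveDimensionLE_of_prod e n hC'

/-! ### Depth zero: finite injective dimension forces self-injectivity. -/

open Abelian in
/-- A dimension-shifted form of Baer's criterion. -/
theorem hasInjectiveDimensionLE_of_forall_ideal (n : ℕ) (M : Type u) [AddCommGroup M] [Module R M]
    (h : ∀ I : Ideal R, Subsingleton (Ext (ModuleCat.of R (R ⧸ I)) (ModuleCat.of R M) (n + 1))) :
    HasInjectiveDimensionLE (ModuleCat.of R M) n := by
  induction n generalizing M with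
  | zero =>
    rw [hasInjectiveDimensionLE_zero_iff]
    refine Module.Baer.injective fun I g ↦ ?_
    have hex := moduleShortComplex_shortExact I.subtype I.mkQ (LinearMap.exact_subtype_mkQ I)
      I.injective_subtype I.mkQ_surjective
    have := h I
    obtain ⟨ψ, hψ⟩ := Ext.contravariant_sequence_exact₁ hex (ModuleCat.of R M)
      (Ext.mk₀ (ModuleCat.ofHom g)) (add_zero 1) (Subsingleton.elim (α := Ext (ModuleCat.of R (R ⧸ I)) (ModuleCat.of R M) 1) _ _)
    obtain ⟨ψ, rfl⟩ := Ext.homEquiv₀.symm.surjective ψ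
    have h2 : ModuleCat.ofHom I.subtype ≫ ψ = ModuleCat.ofHom g :=
      Ext.homEquiv₀.symm.injective (by simpa using hψ)
    refine ⟨ψ.hom, fun x hx ↦ ?_⟩
    exact LinearMap.congr_fun (congrArg ModuleCat.Hom.hom h2) ⟨x, hx⟩
  | succ n ih =>
    obtain ⟨E, _, _, f, hE, hf⟩ := Module.exists_injective_embedding (R := R) M
    rw [← hasInjectiveDimensionLE_succ_iff f _ f.exact_map_mkQ_range hf (mkQ_surjective _) n]
    -- Ext of degree n + 1 into the cokernel embeds in Ext of degree n + 2 into M, as E is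
    -- injective.
    refine ih _ fun I ↦ ?_
    have hex := moduleShortComplex_shortExact f _ f.exact_map_mkQ_range hf (mkQ_surjective _)
    have := Module.injective_object_of_injective_module R E
    have := h I
    refine subsingleton_of_forall_eq 0 fun x₃ ↦ ?_
    obtain ⟨x₂, rfl⟩ := Ext.covariant_sequence_exact₃ (ModuleCat.of R (R ⧸ I)) hex x₃ rfl
      (Subsingleton.elim (α := Ext (ModuleCat.of R (R ⧸ I)) (ModuleCat.of R M) (n + 1 + 1)) _ _)
    rw [Ext.eq_zero_of_injective (I := ModuleCat.of R E) x₂, Ext.zero_comp]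

/-- The linear map `r ↦ r s` on `R ⧸ 𝔪`, for an element `s` killed by `𝔪`. -/
def residueLift [IsLocalRing R] {M : Type*} [AddCommGroup M] [Module R M] (s : M)
    (hs : ∀ y ∈ IsLocalRing.maximalIdeal R, y • s = 0) :
    (R ⧸ IsLocalRing.maximalIdeal R) →ₗ[R] M :=
  Submodule.liftQ _ (LinearMap.toSpanSingleton R M s) fun y hy ↦ hs y hy

theorem residueLift_injective [IsLocalRing R] {M : Type*} [AddCommGroup M] [Module R M] {s : M}
    (hs : ∀ y ∈ IsLocalRing.maximalIdeal R, y • s = 0) (h0 : s ≠ 0) :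
    Function.Injective (residueLift s hs) := by
  rw [← LinearMap.ker_eq_bot, eq_bot_iff]
  intro q hq
  obtain ⟨r, rfl⟩ := Submodule.mkQ_surjective _ q
  have hr : r • s = 0 := hq
  refine (Submodule.Quotient.mk_eq_zero _).2 (by_contra fun hn ↦ h0 ?_)
  have hu : IsUnit r := by simpa using hn
  exact hu.smul_eq_zero.1 hr

open Abelian in
-- Ext in degree n + 2 into R vanishes; a prime filtration carries this down one degree. The residue
-- field embeds in R through s, so its Ext is a quotient of Ext(R, R) = 0. For another prime p, some
-- x ∈ 𝔪 is regular on R/p, so x acts surjectively on the finitely generated Ext module, which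
-- vanishes by Nakayama.
theorem subsingleton_ext_succ_of_smul_eq_zero [IsLocalRing R] [IsNoetherianRing R] {s : R}
    (h0 : s ≠ 0) (hs : ∀ y ∈ IsLocalRing.maximalIdeal R, y • s = 0) (n : ℕ)
    (h : HasInjectiveDimensionLE (ModuleCat.of R R) (n + 1)) (N : Type u) [AddCommGroup N]
    [Module R N] [hN : Module.Finite R N] :
    Subsingleton (Ext (ModuleCat.of R N) (ModuleCat.of R R) (n + 1)) := by
  have hvan (X : ModuleCat.{u} R) : Subsingleton (Ext X (ModuleCat.of R R) (n + 1 + 1)) :=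
    HasInjectiveDimensionLT.subsingleton _ _ _ le_rfl X
  induction hN using IsNoetherianRing.induction_on_isQuotientEquivQuotientPrime R with
  | subsingleton N =>
    refine subsingleton_of_forall_eq 0 fun x ↦ ?_
    have hz : Limits.IsZero (ModuleCat.of R N) := ModuleCat.isZero_of_subsingleton _
    rw [← x.mk₀_id_comp, hz.eq_zero_of_src (𝟙 _), Ext.mk₀_zero, Ext.zero_comp]
  | quotient N p e =>
    by_cases hp : p.1 = IsLocalRing.maximalIdeal R
    · let f : N →ₗ[R] R := residueLift s hs ∘ₗ (Submodule.quotEquivOfEq _ _ hp).toLinearMap ∘ₗ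
        e.toLinearMap
      have hf : Function.Injective f := (residueLift_injective hs h0).comp
        ((Submodule.quotEquivOfEq _ _ hp).injective.comp e.injective)
      have hex := moduleShortComplex_shortExact f _ f.exact_map_mkQ_range hf (mkQ_surjective _)
      refine subsingleton_of_forall_eq 0 fun x₁ ↦ ?_
      have := hvan (ModuleCat.of R (R ⧸ LinearMap.range f))
      obtain ⟨x₂, rfl⟩ := Ext.contravariant_sequence_exact₁ hex (ModuleCat.of R R) x₁
        (add_comm 1 (n + 1)) (Subsingleton.elim
          (α := Ext (ModuleCat.of R (R ⧸ LinearMap.range f)) (ModuleCat.of R R) (n + 1 + 1)) _ _)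
      have : Projective (ModuleCat.of R R) := inferInstance
      rw [Ext.eq_zero_of_projective (P := ModuleCat.of R R) x₂, Ext.comp_zero]
    · obtain ⟨x, hxm, hxp⟩ : ∃ x ∈ IsLocalRing.maximalIdeal R, x ∉ p.1 := by
        by_contra! hc
        exact hp (le_antisymm (IsLocalRing.le_maximalIdeal p.2.ne_top) hc)
      let f : N →ₗ[R] N := LinearMap.lsmul R N x
      have hf : Function.Injective f := by
        rw [← LinearMap.ker_eq_bot, eq_bot_iff]
        intro a ha
        have h1 : x • e a = 0 := by
          rw [← map_smul]
          exact (congrArg e ha).trans (map_zero e)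
        obtain ⟨r, hr⟩ := Submodule.mkQ_surjective _ (e a)
        rw [← hr, ← map_smul] at h1
        have h2 : x * r ∈ p.1 := (Submodule.Quotient.mk_eq_zero _).1 h1
        have h3 : e a = 0 := by
          rw [← hr]
          exact (Submodule.Quotient.mk_eq_zero _).2 ((p.2.mem_or_mem h2).resolve_left hxp)
        simpa using h3
      have hex := moduleShortComplex_shortExact f _ f.exact_map_mkQ_range hf (mkQ_surjective _)
      have htop : (⊤ : Submodule R (Ext (ModuleCat.of R N) (ModuleCat.of R R) (n + 1))) = ⊥ := by
        refine Submodule.eq_bot_of_le_smul_of_le_jacobson_bot (IsLocalRing.maximalIdeal R) _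
          Module.Finite.fg_top (fun x₁ _ ↦ ?_)
          (IsLocalRing.maximalIdeal_le_jacobson _)
        have := hvan (ModuleCat.of R (N ⧸ LinearMap.range f))
        obtain ⟨x₂, rfl⟩ := Ext.contravariant_sequence_exact₁ hex (ModuleCat.of R R) x₁
          (add_comm 1 (n + 1)) (Subsingleton.elim
            (α := Ext (ModuleCat.of R (N ⧸ LinearMap.range f)) (ModuleCat.of R R) (n + 1 + 1)) _ _)
        have : ModuleCat.ofHom f = x • 𝟙 (ModuleCat.of R N) := rfl
        change (Ext.mk₀ (ModuleCat.ofHom f)).comp _ _ ∈ _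
        rw [this, Ext.mk₀_smul, Ext.smul_comp, Ext.mk₀_id_comp]
        exact Submodule.smul_mem_smul hxm trivial
      exact (Submodule.subsingleton_iff R).1 (subsingleton_of_bot_eq_top htop.symm)
  | exact N₁ N₂ N₃ f g hf hg hfg h₁ h₃ =>
    have hex := moduleShortComplex_shortExact f g hfg hf hg
    refine subsingleton_of_forall_eq 0 fun x₂ ↦ ?_
    obtain ⟨x₃, rfl⟩ := Ext.contravariant_sequence_exact₂ hex (ModuleCat.of R R) x₂
      (Subsingleton.elim (α := Ext (ModuleCat.of R N₁) (ModuleCat.of R R) (n + 1)) _ _)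
    rw [Subsingleton.elim (α := Ext (ModuleCat.of R N₃) (ModuleCat.of R R) (n + 1)) x₃ 0,
      Ext.comp_zero]

/-- A Noetherian local ring of depth zero and of finite injective dimension is self-injective. -/
theorem Module.Injective.of_hasInjectiveDimensionLE [IsLocalRing R] [IsNoetherianRing R] {s : R}
    (h0 : s ≠ 0) (hs : ∀ y ∈ IsLocalRing.maximalIdeal R, y • s = 0) (n : ℕ)
    (h : HasInjectiveDimensionLE (ModuleCat.of R R) n) : Module.Injective R R := by
  induction n with
  | zero => rwa [hasInjectiveDimensionLE_zero_iff] at h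
  | succ n ih =>
    exact ih (hasInjectiveDimensionLE_of_forall_ideal n R fun I ↦
      subsingleton_ext_succ_of_smul_eq_zero h0 hs n h (R ⧸ I))

/-- The socle of a self-injective local ring is generated by any nonzero element of it. -/
theorem Module.Injective.mem_span_singleton_of_smul_eq_zero [IsLocalRing R] [Module.Injective R R]
    {s t : R} (h0 : s ≠ 0) (hs : ∀ y ∈ IsLocalRing.maximalIdeal R, y • s = 0)
    (ht : ∀ y ∈ IsLocalRing.maximalIdeal R, y • t = 0) : t ∈ Ideal.span {s} := by
  obtain ⟨h, hh⟩ := Module.Injective.extension_property R R _ _ (residueLift s hs)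
    (residueLift_injective hs h0) (residueLift t ht)
  have h1 : h ((1 : R) • s) = (1 : R) • t := LinearMap.congr_fun hh (Submodule.mkQ _ 1)
  rw [one_smul, one_smul, ← mul_one s, ← smul_eq_mul, map_smul] at h1
  exact Ideal.mem_span_singleton'.2 ⟨h 1, by rw [mul_comm]; exact h1⟩

/-- The maximal ideal is the only prime ideal of a self-injective Noetherian local ring of depth
zero. -/
theorem Module.Injective.eq_maximalIdeal_of_isPrime [IsLocalRing R] [IsNoetherianRing R]
    [Module.Injective R R] {s : R} (h0 : s ≠ 0)
    (hs : ∀ y ∈ IsLocalRing.maximalIdeal R, y • s = 0) (p : Ideal R) [hp : p.IsPrime] :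
    p = IsLocalRing.maximalIdeal R := by
  by_contra hne
  obtain ⟨x, hxm, hxp⟩ : ∃ x ∈ IsLocalRing.maximalIdeal R, x ∉ p := by
    by_contra! hc
    exact hne (le_antisymm (IsLocalRing.le_maximalIdeal hp.ne_top) hc)
  let f : (R ⧸ p) →ₗ[R] (R ⧸ p) := LinearMap.lsmul R _ x
  have hf : Function.Injective f := by
    rw [← LinearMap.ker_eq_bot, eq_bot_iff]
    intro a ha
    obtain ⟨r, rfl⟩ := Submodule.mkQ_surjective _ a
    have h2 : x * r ∈ p := (Submodule.Quotient.mk_eq_zero _).1 ha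
    exact (Submodule.Quotient.mk_eq_zero _).2 ((hp.mem_or_mem h2).resolve_left hxp)
  -- By injectivity of R, multiplication by x is onto on Hom(R/p, R), which is therefore zero by
  -- Nakayama; but R/p → R/𝔪 → R is a nonzero element of it.
  have htop : (⊤ : Submodule R ((R ⧸ p) →ₗ[R] R)) = ⊥ := by
    refine Submodule.eq_bot_of_le_smul_of_le_jacobson_bot (IsLocalRing.maximalIdeal R) _
      Module.Finite.fg_top (fun g _ ↦ ?_) (IsLocalRing.maximalIdeal_le_jacobson _)
    obtain ⟨h, rfl⟩ := Module.Injective.extension_property R R _ _ f hf g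
    have : h ∘ₗ f = x • h := by
      ext
      exact h.map_smul x _
    rw [this]
    exact Submodule.smul_mem_smul hxm trivial
  let g : (R ⧸ p) →ₗ[R] R := residueLift s hs ∘ₗ
    Submodule.factor (IsLocalRing.le_maximalIdeal hp.ne_top)
  have hg : g = 0 := (Submodule.mem_bot R).1 (htop ▸ Submodule.mem_top)
  apply h0
  have h1 : (1 : R) • s = 0 := LinearMap.congr_fun hg (Submodule.mkQ _ 1)
  rwa [one_smul] at h1

end InjectiveDimension

/-! ### Dimension and associated primes of local rings. -/

open IsLocalRing

theorem ringKrullDim_eq_natCast (R : Type*) [CommRing R] [FiniteRingKrullDim R] :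
    ∃ n : ℕ, ringKrullDim R = n := by
  have h1 := ringKrullDim_ne_bot (R := R)
  have h2 := ringKrullDim_ne_top (R := R)
  generalize ringKrullDim R = d at h1 h2
  induction d with
  | bot => exact absurd rfl h1
  | coe d =>
    induction d with
    | top => exact absurd rfl h2
    | coe n => exact ⟨n, rfl⟩

theorem isLocalRing_quotient {A : Type*} [CommRing A] [IsLocalRing A] {J : Ideal A} (hJ : J ≠ ⊤) :
    IsLocalRing (A ⧸ J) :=
  have : Nontrivial (A ⧸ J) := Ideal.Quotient.nontrivial_iff.mpr hJ
  IsLocalRing.of_surjective' (Ideal.Quotient.mk J) Ideal.Quotient.mk_surjective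

theorem mk_mem_maximalIdeal_iff {A : Type*} [CommRing A] [IsLocalRing A] {J : Ideal A}
    [IsLocalRing (A ⧸ J)] {x : A} :
    Ideal.Quotient.mk J x ∈ maximalIdeal (A ⧸ J) ↔ x ∈ maximalIdeal A := by
  have := IsLocalHom.of_surjective (Ideal.Quotient.mk J) Ideal.Quotient.mk_surjective
  rw [mem_maximalIdeal, mem_maximalIdeal, mem_nonunits_iff, mem_nonunits_iff, isUnit_map_iff]

theorem notMem_of_mem_associatedPrimes {R : Type*} [CommRing R] [IsNoetherianRing R] {p : Ideal R}
    (hp : p ∈ associatedPrimes R R) {a : R} (ha : a ∈ nonZeroDivisors R) : a ∉ p := fun hap ↦ by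
  have : a ∈ ⋃ p ∈ associatedPrimes R R, (p : Set R) := Set.mem_biUnion hp hap
  rw [biUnion_associatedPrimes_eq_compl_nonZeroDivisors] at this
  exact this ha

theorem exists_mem_maximalIdeal_mem_nonZeroDivisors {A : Type*} [CommRing A] [IsLocalRing A]
    [IsNoetherianRing A] (h : maximalIdeal A ∉ associatedPrimes A A) :
    ∃ x ∈ maximalIdeal A, x ∈ nonZeroDivisors A := by
  by_contra! hc
  have hsub : (maximalIdeal A : Set A) ⊆ ⋃ p ∈ associatedPrimes A A, (p : Set A) := by
    rw [biUnion_associatedPrimes_eq_compl_nonZeroDivisors]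
    exact hc
  obtain ⟨p, hp, hle⟩ := (Ideal.subset_union_prime_finite (f := id)
    (associatedPrimes.finite A A) ⊥ ⊥ fun p hp _ _ ↦ IsAssociatedPrime.isPrime hp).1 hsub
  have := (maximalIdeal.isMaximal A).eq_of_le (IsAssociatedPrime.isPrime hp).ne_top hle
  exact h (this ▸ hp)

/-! ### Gorenstein local rings: quotients and unmixedness. -/

namespace IsGorensteinLocalRing

section RingEquiv

attribute [local instance] RingHomInvPair.of_ringEquiv

theorem of_ringEquiv {A B : Type u} [CommRing A] [CommRing B] [IsGorensteinLocalRing A]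
    (e : A ≃+* B) : IsGorensteinLocalRing B := by
  have := e.isLocalRing
  have := isNoetherianRing_of_ringEquiv A e
  obtain ⟨n, hn⟩ := finite_injectiveDimension (A := A)
  let l : ModuleCat.of A A ≃ₛₗ[RingHomClass.toRingHom e] ModuleCat.of B B :=
    { e with map_smul' := fun a b ↦ e.map_mul a b }
  exact ⟨n, (ModuleCat.hasInjectiveDimensionLE_iff_of_semiLinearEquiv e l n).1 hn⟩

end RingEquiv

variable {A : Type u} [CommRing A] [IsGorensteinLocalRing A]

theorem quotient_span_singleton {x : A} (hx : x ∈ maximalIdeal A) (h0 : x ∈ nonZeroDivisors A) :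
    IsGorensteinLocalRing (A ⧸ Ideal.span {x}) := by
  have : IsLocalRing (A ⧸ Ideal.span {x}) := isLocalRing_quotient fun h ↦
    (maximalIdeal.isMaximal A).ne_top (top_le_iff.1 (h ▸ (Ideal.span_singleton_le_iff_mem _).2 hx))
  obtain ⟨n, hn⟩ := finite_injectiveDimension (A := A)
  exact ⟨n, hasInjectiveDimensionLE_quotient_span_singleton h0 n hn⟩

theorem injective {s : A} (h0 : s ≠ 0) (hs : ∀ y ∈ maximalIdeal A, y • s = 0) :
    Module.Injective A A := by
  obtain ⟨n, hn⟩ := finite_injectiveDimension (A := A)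
  exact Module.Injective.of_hasInjectiveDimensionLE h0 hs n hn

theorem eq_maximalIdeal_of_mem_associatedPrimes (h : maximalIdeal A ∈ associatedPrimes A A)
    (p : Ideal A) [p.IsPrime] : p = maximalIdeal A := by
  obtain ⟨hm, s, hs⟩ := isAssociatedPrime_iff.1 h
  have hs' : ∀ y ∈ maximalIdeal A, y • s = 0 := fun y hy ↦ by
    rw [hs] at hy
    simpa [Submodule.mem_colon_singleton] using hy
  have h0 : s ≠ 0 := by
    rintro rfl
    exact hm.ne_top (by rw [hs]; ext; simp)
  have := injective h0 hs'
  exact Module.Injective.eq_maximalIdeal_of_isPrime h0 hs' p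

end IsGorensteinLocalRing

/-- Let p be the annihilator of y. By Krull's intersection theorem y = x^k z with z ∉ (x); as x^k is
regular, p kills z, so p kills a nonzero element of A/(x). -/
theorem exists_mem_associatedPrimes_quotient {A : Type u} [CommRing A] [IsLocalRing A]
    [IsNoetherianRing A] {x : A} (hx : x ∈ maximalIdeal A) (h0 : x ∈ nonZeroDivisors A)
    {p : Ideal A} (hp : p ∈ associatedPrimes A A) :
    ∃ q ∈ associatedPrimes (A ⧸ Ideal.span {x}) (A ⧸ Ideal.span {x}),
      p ≤ q.comap (Ideal.Quotient.mk _) := by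
  obtain ⟨hm, y, hy⟩ := isAssociatedPrime_iff.1 hp
  have hy0 : y ≠ 0 := by
    rintro rfl
    exact hm.ne_top (by rw [hy]; ext; simp)
  obtain ⟨k, z, hz, rfl⟩ : ∃ (k : ℕ) (z : A), z ∉ Ideal.span {x} ∧ y = x ^ k * z := by
    have hne : Ideal.span {x} ≠ ⊤ := fun h ↦
      (maximalIdeal.isMaximal A).ne_top
        (top_le_iff.1 (h ▸ (Ideal.span_singleton_le_iff_mem _).2 hx))
    have hex : ∃ k, y ∉ Ideal.span {x} ^ k := by
      by_contra! hc
      have : y ∈ ⨅ k, Ideal.span {x} ^ k := by simpa using hc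
      rw [Ideal.iInf_pow_eq_bot_of_isLocalRing _ hne] at this
      exact hy0 this
    classical
    have h1 := Nat.find_spec hex
    have h2 : Nat.find hex ≠ 0 := fun h ↦ by
      rw [h] at h1
      simp at h1
    obtain ⟨k, hk⟩ := Nat.exists_eq_succ_of_ne_zero h2
    have h3 : y ∈ Ideal.span {x} ^ k := by
      by_contra hc
      exact Nat.find_min hex (hk ▸ Nat.lt_succ_self k) hc
    rw [Ideal.span_singleton_pow, Ideal.mem_span_singleton'] at h3
    obtain ⟨z, rfl⟩ := h3
    refine ⟨k, z, fun hz ↦ h1 ?_, mul_comm _ _⟩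
    rw [hk, pow_succ']
    exact Ideal.mul_mem_mul hz (Ideal.pow_mem_pow (Ideal.mem_span_singleton_self x) k)
  have hz' : Ideal.Quotient.mk (Ideal.span {x}) z ≠ 0 := fun h ↦
    hz (Ideal.Quotient.eq_zero_iff_mem.1 h)
  obtain ⟨q, hq, hle⟩ := exists_le_isAssociatedPrime_of_isNoetherianRing (A ⧸ Ideal.span {x}) _ hz'
  refine ⟨q, hq, fun r hr ↦ hle ?_⟩
  rw [Submodule.mem_colon_singleton, Submodule.mem_bot, smul_eq_mul, ← map_mul]
  have h1 : r * (x ^ k * z) = 0 := by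
    rw [hy] at hr
    simpa [Submodule.mem_colon_singleton] using hr
  have h2 : x ^ k * (r * z) = 0 := by rw [← h1]; ring
  rw [(mul_right_mem_nonZeroDivisors_eq_zero_iff (pow_mem h0 k)).1 ((mul_comm _ _).trans h2),
    map_zero]

namespace IsGorensteinLocalRing

/-- Gorenstein local rings are unmixed. -/
theorem ringKrullDim_le_of_mem_associatedPrimes {A : Type u} [CommRing A] [IsGorensteinLocalRing A]
    {p : Ideal A} (hp : p ∈ associatedPrimes A A) : ringKrullDim A ≤ ringKrullDim (A ⧸ p) := by
  obtain ⟨n, hn⟩ := ringKrullDim_eq_natCast A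
  induction n generalizing A with
  | zero =>
    have := Ideal.Quotient.nontrivial_iff.mpr (IsAssociatedPrime.isPrime hp).ne_top
    rw [hn]
    exact ringKrullDim_nonneg_of_nontrivial
  | succ n ih =>
    -- Depth zero would force dimension zero. Otherwise pass to A/(x) with x regular; x ∉ p makes
    -- the dimension drop from A/p to the quotient by q.
    by_cases hm : maximalIdeal A ∈ associatedPrimes A A
    · have : Ring.KrullDimLE 0 A := Ring.KrullDimLE.mk₀ fun I hI ↦ by
        rw [eq_maximalIdeal_of_mem_associatedPrimes hm I]
        infer_instance
      have := (ringKrullDimZero_iff_ringKrullDim_eq_zero (R := A)).1 this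
      rw [this] at hn
      have : (0 : ℕ) = n + 1 := by exact_mod_cast hn
      omega
    · obtain ⟨x, hx, h0⟩ := exists_mem_maximalIdeal_mem_nonZeroDivisors hm
      have := quotient_span_singleton hx h0
      obtain ⟨k, hk⟩ := ringKrullDim_eq_natCast (A ⧸ Ideal.span {x})
      have hdim := ringKrullDim_quotient_span_singleton_succ_eq_ringKrullDim_of_mem_nonZeroDivisors
        h0 hx
      have hk' : k = n := by
        rw [hk, hn] at hdim
        have : k + 1 = n + 1 := by exact_mod_cast hdim
        omega
      obtain ⟨q, hq, hle⟩ := exists_mem_associatedPrimes_quotient hx h0 hp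
      have hqp := IsAssociatedPrime.isPrime hq
      have hpp := IsAssociatedPrime.isPrime hp
      rw [← hdim]
      refine (add_le_add_left (ih hq (hk' ▸ hk)) 1).trans ?_
      have hxp := notMem_of_mem_associatedPrimes hp h0
      refine ringKrullDim_succ_le_of_surjective (Ideal.Quotient.lift p
        ((Ideal.Quotient.mk q).comp (Ideal.Quotient.mk (Ideal.span {x})))
        fun a ha ↦ Ideal.Quotient.eq_zero_iff_mem.2 (hle ha))
        (Ideal.Quotient.lift_surjective_of_surjective _ _
          (Ideal.Quotient.mk_surjective.comp Ideal.Quotient.mk_surjective))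
        (r := Ideal.Quotient.mk p x) ?_ ?_
      · exact mem_nonZeroDivisors_of_ne_zero fun h ↦ hxp (Ideal.Quotient.eq_zero_iff_mem.1 h)
      · rw [Ideal.Quotient.lift_mk, RingHom.comp_apply, Ideal.Quotient.eq_zero_iff_mem.2
          (Ideal.mem_span_singleton_self x), map_zero]

/-- A zero divisor x lies in an associated prime p, and dim A/(x) ≥ dim A/p ≥ dim A by unmixedness.
-/
theorem mem_nonZeroDivisors_of_ringKrullDim_lt {A : Type u} [CommRing A] [IsGorensteinLocalRing A]
    {x : A} (h : ringKrullDim (A ⧸ Ideal.span {x}) < ringKrullDim A) : x ∈ nonZeroDivisors A := by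
  by_contra hc
  have : x ∈ ⋃ p ∈ associatedPrimes A A, (p : Set A) := by
    rw [biUnion_associatedPrimes_eq_compl_nonZeroDivisors]
    exact hc
  obtain ⟨p, hp, hxp⟩ := Set.mem_iUnion₂.1 this
  refine (h.trans_le (ringKrullDim_le_of_mem_associatedPrimes hp)).not_ge ?_
  exact ringKrullDim_le_of_surjective
    (Ideal.Quotient.factor ((Ideal.span_singleton_le_iff_mem p).2 hxp))
    (Ideal.Quotient.factor_surjective _)

/-- The quotient of a Gorenstein local ring by a part of a system of parameters is Gorenstein. -/
theorem quotient_span_finset {A : Type u} [CommRing A] [IsGorensteinLocalRing A] (S : Finset A)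
    (hS : (S : Set A) ⊆ maximalIdeal A)
    (h : ringKrullDim (A ⧸ Ideal.span (S : Set A)) + S.card ≤ ringKrullDim A) :
    IsGorensteinLocalRing (A ⧸ Ideal.span (S : Set A)) := by
  classical
  induction S using Finset.induction_on with
  | empty =>
    exact of_ringEquiv ((RingEquiv.quotientBot A).symm.trans
      (Ideal.quotEquivOfEq (by simp)))
  | insert x S hxS ih =>
    rw [Finset.coe_insert, Set.insert_subset_iff] at hS
    obtain ⟨hx, hS⟩ := hS
    have hne (T : Finset A) (hT : (T : Set A) ⊆ maximalIdeal A) : Ideal.span (T : Set A) ≠ ⊤ :=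
      fun h ↦ (maximalIdeal.isMaximal A).ne_top (top_le_iff.1 (h ▸ Ideal.span_le.2 hT))
    have hl := isLocalRing_quotient (hne S hS)
    have hl' := isLocalRing_quotient (hne (insert x S) (by
      rw [Finset.coe_insert, Set.insert_subset_iff]; exact ⟨hx, hS⟩))
    let x' := Ideal.Quotient.mk (Ideal.span (S : Set A)) x
    have hx' : x' ∈ maximalIdeal (A ⧸ Ideal.span (S : Set A)) := mk_mem_maximalIdeal_iff.2 hx
    let e : ((A ⧸ Ideal.span (S : Set A)) ⧸ Ideal.span {x'}) ≃+*
        A ⧸ Ideal.span ((insert x S : Finset A) : Set A) :=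
      (Ideal.quotEquivOfEq (by rw [Ideal.map_span, Set.image_singleton])).trans
        ((DoubleQuot.quotQuotEquivQuotSup (Ideal.span (S : Set A)) (Ideal.span {x})).trans
          (Ideal.quotEquivOfEq (by
            rw [Finset.coe_insert, Set.insert_eq, Ideal.span_union, sup_comm])))
    obtain ⟨a, ha⟩ := ringKrullDim_eq_natCast A
    obtain ⟨b, hb⟩ := ringKrullDim_eq_natCast (A ⧸ Ideal.span (S : Set A))
    obtain ⟨c, hc⟩ := ringKrullDim_eq_natCast (A ⧸ Ideal.span ((insert x S : Finset A) : Set A))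
    -- Each element lowers the dimension by at most one, so the bound for the whole set gives the
    -- bound for S and a strict drop at x.
    have h1 := ringKrullDim_le_ringKrullDim_quotient_add_card ({x'} : Finset _)
      (by simpa [IsLocalRing.ringJacobson_eq_maximalIdeal] using hx')
    rw [Finset.coe_singleton, ringKrullDim_eq_of_ringEquiv e, hb, hc, Finset.card_singleton] at h1
    have h2 := ringKrullDim_le_ringKrullDim_quotient_add_card S
      (by simpa [IsLocalRing.ringJacobson_eq_maximalIdeal] using hS)
    rw [ha, hb] at h2
    rw [ha, hc, Finset.card_insert_of_notMem hxS] at h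
    rw [ha, hb] at ih
    norm_cast at h1 h2 h ih
    have := ih hS (by omega)
    have h3 : x' ∈ nonZeroDivisors _ := mem_nonZeroDivisors_of_ringKrullDim_lt (by
      rw [ringKrullDim_eq_of_ringEquiv e, hb, hc]
      norm_cast
      omega)
    have := quotient_span_singleton hx' h3
    exact of_ringEquiv e

end IsGorensteinLocalRing

/-! ### Lengths modulo powers of an ideal, and the multiplicity. -/

section PowersOfIdeals

variable {A : Type*} [CommRing A] {d : ℕ} (b : Fin d → A)

/-- The monomial in the elements `b i` given by a multiset of indices. -/
def symMonomial {n : ℕ} (s : Sym (Fin d) n) : A := ((s : Multiset (Fin d)).map b).prod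

theorem symMonomial_cons {n : ℕ} (i : Fin d) (s : Sym (Fin d) n) :
    symMonomial b (i ::ₛ s) = b i * symMonomial b s := by
  rw [symMonomial, Sym.coe_cons, Multiset.map_cons, Multiset.prod_cons, symMonomial]

theorem span_range_pow_eq_span_range_symMonomial (n : ℕ) :
    Ideal.span (Set.range b) ^ n = Ideal.span (Set.range (symMonomial b (n := n))) := by
  induction n with
  | zero =>
    rw [pow_zero, Ideal.one_eq_top, eq_comm, Ideal.eq_top_iff_one]
    exact Ideal.subset_span ⟨Sym.nil, by simp [symMonomial]⟩
  | succ n ih =>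
    rw [pow_succ', ih, Ideal.span_mul_span']
    congr 1
    ext x
    constructor
    · rintro ⟨_, ⟨i, rfl⟩, _, ⟨s, rfl⟩, rfl⟩
      exact ⟨i ::ₛ s, symMonomial_cons b i s⟩
    · rintro ⟨s, rfl⟩
      obtain ⟨i, s, rfl⟩ := s.exists_eq_cons_of_succ
      exact ⟨_, ⟨i, rfl⟩, _, ⟨s, rfl⟩, (symMonomial_cons b i s).symm⟩

/-- The degree n monomials in b give a surjection from copies of A/Q onto Q^n/Q^(n+1). -/
theorem length_quotient_pow_succ_le (n : ℕ) :
    Module.length A (A ⧸ Ideal.span (Set.range b) ^ (n + 1)) ≤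
      Module.length A (A ⧸ Ideal.span (Set.range b) ^ n) +
        Nat.multichoose d n * Module.length A (A ⧸ Ideal.span (Set.range b)) := by
  set Q := Ideal.span (Set.range b) with hQ
  have hmem (s : Sym (Fin d) n) : symMonomial b s ∈ Q ^ n := by
    rw [hQ, span_range_pow_eq_span_range_symMonomial]
    exact Ideal.subset_span ⟨s, rfl⟩
  let c (s : Sym (Fin d) n) : (A ⧸ Q) →ₗ[A] A ⧸ Q ^ (n + 1) :=
    Submodule.liftQ Q (LinearMap.toSpanSingleton A _ (Submodule.mkQ (Q ^ (n + 1)) (symMonomial b s)))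
      fun y hy ↦ by
        rw [LinearMap.mem_ker, LinearMap.toSpanSingleton_apply, ← map_smul]
        refine (Submodule.Quotient.mk_eq_zero _).2 ?_
        rw [pow_succ']
        exact Ideal.mul_mem_mul hy (hmem s)
  let f : (Sym (Fin d) n → A ⧸ Q) →ₗ[A] A ⧸ Q ^ (n + 1) :=
    LinearMap.lsum A _ A c
  let g : (A ⧸ Q ^ (n + 1)) →ₗ[A] A ⧸ Q ^ n := Submodule.factor (Ideal.pow_le_pow_right n.le_succ)
  have hg : LinearMap.ker g ≤ LinearMap.range f := by
    intro q hq
    obtain ⟨a, rfl⟩ := Submodule.mkQ_surjective _ q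
    have ha : a ∈ Q ^ n := (Submodule.Quotient.mk_eq_zero _).1 hq
    rw [hQ, span_range_pow_eq_span_range_symMonomial] at ha
    induction ha using Submodule.span_induction with
    | mem x hx =>
      obtain ⟨s, rfl⟩ := hx
      refine ⟨Pi.single s (Submodule.mkQ Q 1), ?_⟩
      rw [LinearMap.lsum_piSingle]
      exact one_smul A (Submodule.mkQ (Q ^ (n + 1)) (symMonomial b s))
    | zero => simp
    | add x y hx hy hx' hy' =>
      rw [map_add]
      refine add_mem (hx' ?_) (hy' ?_)
      all_goals
        refine (Submodule.Quotient.mk_eq_zero _).2 ?_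
        rw [hQ, span_range_pow_eq_span_range_symMonomial]
        assumption
    | smul r x hx hx' =>
      rw [map_smul]
      refine Submodule.smul_mem _ _ (hx' ?_)
      refine (Submodule.Quotient.mk_eq_zero _).2 ?_
      rw [hQ, span_range_pow_eq_span_range_symMonomial]
      assumption
  have h1 := Module.length_eq_add_of_exact (LinearMap.ker g).subtype g
    (Submodule.subtype_injective _) (Submodule.factor_surjective _)
    (LinearMap.exact_subtype_ker_map g)
  have h2 : Module.length A (LinearMap.ker g) ≤ Module.length A (LinearMap.range f) :=
    Module.length_le_of_injective (Submodule.inclusion hg) (Submodule.inclusion_injective hg)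
  have h3 : Module.length A (LinearMap.range f) ≤ Module.length A (Sym (Fin d) n → A ⧸ Q) :=
    Module.length_le_of_surjective f.rangeRestrict f.surjective_rangeRestrict
  have h4 : Module.length A (Sym (Fin d) n → A ⧸ Q) =
      Nat.multichoose d n * Module.length A (A ⧸ Q) := by
    rw [Module.length_pi_of_fintype]
    simp [Sym.card_sym_eq_multichoose]
  rw [h1, add_comm, ← h4]
  gcongr
  exact h2.trans h3

theorem length_quotient_pow_succ_le_multichoose (n : ℕ) :
    Module.length A (A ⧸ Ideal.span (Set.range b) ^ (n + 1)) ≤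
      Nat.multichoose (d + 1) n * Module.length A (A ⧸ Ideal.span (Set.range b)) := by
  induction n with
  | zero => rw [zero_add, pow_one, Nat.multichoose_zero_right, Nat.cast_one, one_mul]
  | succ n ih =>
    refine (length_quotient_pow_succ_le b (n + 1)).trans ?_
    rw [Nat.multichoose_succ_succ, Nat.cast_add, add_mul, add_comm]
    gcongr

/-- The bound is wasteful so as to read (m + d)^d with m = n + 1; divided by m^d it tends to 1. -/
theorem factorial_mul_multichoose_le (d n : ℕ) :
    d ! * Nat.multichoose (d + 1) n ≤ (n + 1 + d) ^ d := by
  rw [Nat.multichoose_eq, show d + 1 + n - 1 = n + d by omega, Nat.choose_symm_add, mul_comm, mul_comm,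
    ← Nat.descFactorial_eq_factorial_mul_choose]
  exact (Nat.descFactorial_le_pow _ _).trans (Nat.pow_le_pow_left (by omega) d)

end PowersOfIdeals

/-- The multiplicity of a local ring is at most the colength of any ideal generated by
`dim A` elements. -/
theorem localMultiplicity_le_length {A : Type*} [CommRing A] [IsLocalRing A] {d : ℕ}
    (hd : ringKrullDim A = d) (b : Fin d → A) (hb : ∀ i, b i ∈ maximalIdeal A) :
    localMultiplicity A ≤ (Module.length A (A ⧸ Ideal.span (Set.range b)) : ℕ∞) := by
  have hd' : krullDimNat A = d := by simp [krullDimNat, hd]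
  rw [localMultiplicity, hd']
  set ℓ : ℝ≥0∞ := ((Module.length A (A ⧸ Ideal.span (Set.range b)) : ℕ∞) : ℝ≥0∞) with hℓ
  have hlim : Tendsto (fun n : ℕ ↦ (1 + d * (n : ℝ≥0∞)⁻¹) ^ d * ℓ) atTop (nhds ℓ) := by
    have h1 : Tendsto (fun n : ℕ ↦ (d : ℝ≥0∞) * (n : ℝ≥0∞)⁻¹) atTop (nhds 0) := by
      simpa using ENNReal.Tendsto.const_mul (a := (d : ℝ≥0∞)) ENNReal.tendsto_inv_nat_nhds_zero
        (Or.inr (ENNReal.natCast_ne_top d))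
    have h2 : Tendsto (fun n : ℕ ↦ (1 + d * (n : ℝ≥0∞)⁻¹) ^ d) atTop (nhds 1) := by
      simpa using ENNReal.Tendsto.pow (n := d) (tendsto_const_nhds.add h1 : Tendsto
        (fun n : ℕ ↦ (1 : ℝ≥0∞) + d * (n : ℝ≥0∞)⁻¹) atTop (nhds (1 + 0)))
    simpa using ENNReal.Tendsto.mul_const h2 (Or.inl one_ne_zero)
  rw [← hlim.limsup_eq]
  refine limsup_le_limsup (eventually_atTop.2 ⟨1, fun n hn ↦ ?_⟩)
  obtain ⟨n, rfl⟩ := Nat.exists_eq_succ_of_ne_zero (Nat.one_le_iff_ne_zero.1 hn)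
  have hle : Module.length A (A ⧸ maximalIdeal A ^ (n + 1)) ≤
      Nat.multichoose (d + 1) n * Module.length A (A ⧸ Ideal.span (Set.range b)) := by
    have hQ : Ideal.span (Set.range b) ^ (n + 1) ≤ maximalIdeal A ^ (n + 1) :=
      Ideal.pow_right_mono (Ideal.span_le.2 (by rintro _ ⟨i, rfl⟩; exact hb i)) _
    exact (Module.length_le_of_surjective (Submodule.factor hQ)
      (Submodule.factor_surjective hQ)).trans (length_quotient_pow_succ_le_multichoose b n)
  have hle' : ((Module.length A (A ⧸ maximalIdeal A ^ (n + 1)) : ℕ∞) : ℝ≥0∞) ≤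
      Nat.multichoose (d + 1) n * ℓ := by
    have := ENat.toENNReal_le.2 hle
    simpa [hℓ] using this
  have h0 : ((n + 1 : ℕ) : ℝ≥0∞) ≠ 0 := by simp
  have ht : ((n + 1 : ℕ) : ℝ≥0∞) ≠ ⊤ := ENNReal.natCast_ne_top _
  have hfac : ((d ! : ℕ) : ℝ≥0∞) * Nat.multichoose (d + 1) n ≤ ((n + 1 : ℕ) + d) ^ d := by
    exact_mod_cast factorial_mul_multichoose_le d n
  calc ((d ! : ℕ) : ℝ≥0∞) * ((Module.length A (A ⧸ maximalIdeal A ^ (n + 1)) : ℕ∞) : ℝ≥0∞) /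
        ((n + 1 : ℕ) : ℝ≥0∞) ^ d
      ≤ ((d ! : ℕ) : ℝ≥0∞) * (Nat.multichoose (d + 1) n * ℓ) / ((n + 1 : ℕ) : ℝ≥0∞) ^ d := by
        gcongr
    _ ≤ (((n + 1 : ℕ) + d) ^ d * ℓ) / ((n + 1 : ℕ) : ℝ≥0∞) ^ d := by
        rw [← mul_assoc]
        gcongr
    _ = (1 + d * ((n + 1 : ℕ) : ℝ≥0∞)⁻¹) ^ d * ℓ := by
        rw [div_eq_mul_inv, mul_right_comm, ENNReal.inv_pow, ← mul_pow, add_mul,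
          ENNReal.mul_inv_cancel h0 ht]

/-! ### Systems of parameters. -/

section LocalRing

variable {A : Type u} [CommRing A] [IsLocalRing A]

theorem ringKrullDim_quotient_eq_zero_of_radical_eq {J : Ideal A}
    (h : J.radical = maximalIdeal A) : ringKrullDim (A ⧸ J) = 0 := by
  have hJ : J ≠ ⊤ := by
    rintro rfl
    rw [Ideal.radical_top] at h
    exact (maximalIdeal.isMaximal A).ne_top h.symm
  have : Nontrivial (A ⧸ J) := Ideal.Quotient.nontrivial_iff.mpr hJ
  rw [← ringKrullDimZero_iff_ringKrullDim_eq_zero]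
  have := isLocalRing_quotient hJ
  refine Ring.KrullDimLE.mk₀ fun I hI ↦ ?_
  have hle : maximalIdeal A ≤ I.comap (Ideal.Quotient.mk J) := by
    rw [← h]
    refine (Ideal.IsPrime.radical_le_iff inferInstance).2 fun a ha ↦ ?_
    rw [Ideal.mem_comap, Ideal.Quotient.eq_zero_iff_mem.2 ha]
    exact I.zero_mem
  have hI' : I = maximalIdeal (A ⧸ J) := by
    refine le_antisymm (le_maximalIdeal hI.ne_top) fun q hq ↦ ?_
    obtain ⟨a, rfl⟩ := Ideal.Quotient.mk_surjective q
    exact hle (mk_mem_maximalIdeal_iff.1 hq)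
  rw [hI']
  infer_instance

theorem radical_eq_maximalIdeal_of_ringKrullDim_quotient_eq_zero {J : Ideal A}
    (h : ringKrullDim (A ⧸ J) = 0) : J.radical = maximalIdeal A := by
  have : Nontrivial (A ⧸ J) := by
    by_contra hc
    rw [not_nontrivial_iff_subsingleton] at hc
    rw [ringKrullDim_eq_bot_of_subsingleton] at h
    exact absurd h (by simp)
  have hloc := isLocalRing_quotient (Ideal.Quotient.nontrivial_iff.mp this)
  have := ringKrullDimZero_iff_ringKrullDim_eq_zero.2 h
  ext a
  rw [← mk_mem_maximalIdeal_iff (J := J), ← Ring.KrullDimLE.isNilpotent_iff_mem_maximalIdeal]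
  refine exists_congr fun n ↦ ?_
  rw [← map_pow, Ideal.Quotient.eq_zero_iff_mem]

/-- The third isomorphism theorem for a quotient by an ideal and one further element. -/
def quotientQuotientSpanSingletonEquiv (J : Ideal A) (x : A) :
    ((A ⧸ J) ⧸ Ideal.span {Ideal.Quotient.mk J x}) ≃+* A ⧸ (J ⊔ Ideal.span {x}) :=
  (Ideal.quotEquivOfEq (by rw [Ideal.map_span, Set.image_singleton])).trans
    (DoubleQuot.quotQuotEquivQuotSup J (Ideal.span {x}))

end LocalRing

/-- A family of `d` elements of a local ring of dimension `d` generating an ideal whose radical is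
the maximal ideal. -/
structure IsSystemOfParameters {A : Type*} [CommRing A] [IsLocalRing A] {d : ℕ} (b : Fin d → A) :
    Prop where
  ringKrullDim_eq : ringKrullDim A = d
  radical_eq : (Ideal.span (Set.range b)).radical = maximalIdeal A

/-- The ideal generated by the members of a family with index different from `i`. -/
def spanOmit {A : Type*} [CommRing A] {d : ℕ} (b : Fin d → A) (i : Fin d) : Ideal A :=
  Ideal.span (b '' {i}ᶜ)

section Span

variable {A : Type*} [CommRing A] {d : ℕ} (b : Fin d → A)

theorem mem_spanOmit {i j : Fin d} (h : j ≠ i) : b j ∈ spanOmit b i :=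
  Ideal.subset_span ⟨j, h, rfl⟩

theorem spanOmit_sup_span_singleton (i : Fin d) :
    spanOmit b i ⊔ Ideal.span {b i} = Ideal.span (Set.range b) := by
  rw [spanOmit, ← Ideal.span_union, ← Set.image_singleton, ← Set.image_union,
    Set.compl_union_self, Set.image_univ]

theorem spanOmit_update (i : Fin d) (z : A) :
    spanOmit (Function.update b i z) i = spanOmit b i := by
  rw [spanOmit, spanOmit]
  congr 1
  exact Set.image_congr fun j hj ↦ Function.update_of_ne hj z b

theorem span_range_update (i : Fin d) (z : A) :
    Ideal.span (Set.range (Function.update b i z)) = spanOmit b i ⊔ Ideal.span {z} := by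
  rw [← spanOmit_sup_span_singleton _ i, spanOmit_update, Function.update_self]

end Span

/-- Repeated members may shrink the set; the inequality suffices for dimension counts. -/
theorem exists_finset_coe_eq_image_compl_singleton {α : Type*} {d : ℕ} (b : Fin d → α) (i : Fin d) :
    ∃ S : Finset α, (S : Set α) = b '' {i}ᶜ ∧ S.card + 1 ≤ d := by
  classical
  refine ⟨(Finset.univ.erase i).image b, by ext; simp, ?_⟩
  have h := Finset.card_image_le (s := Finset.univ.erase i) (f := b)
  rw [Finset.card_erase_of_mem (Finset.mem_univ i), Finset.card_univ, Fintype.card_fin] at h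
  have := i.pos
  omega

namespace IsSystemOfParameters

variable {A : Type u} [CommRing A] {d : ℕ} {b : Fin d → A}

theorem mem_maximalIdeal [IsLocalRing A] (hb : IsSystemOfParameters b) (i : Fin d) :
    b i ∈ maximalIdeal A := by
  rw [← hb.radical_eq]
  exact Ideal.le_radical (Ideal.subset_span ⟨i, rfl⟩)

theorem span_ne_top [IsLocalRing A] (hb : IsSystemOfParameters b) :
    Ideal.span (Set.range b) ≠ ⊤ := fun h ↦
  (maximalIdeal.isMaximal A).ne_top (by rw [← hb.radical_eq, h, Ideal.radical_top])

theorem spanOmit_ne_top [IsLocalRing A] (hb : IsSystemOfParameters b) (i : Fin d) :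
    spanOmit b i ≠ ⊤ := fun h ↦
  hb.span_ne_top (by rw [← spanOmit_sup_span_singleton b i, h, top_sup_eq])

variable [IsGorensteinLocalRing A]

theorem isLocalRing_quotient_spanOmit (hb : IsSystemOfParameters b) (i : Fin d) :
    IsLocalRing (A ⧸ spanOmit b i) := isLocalRing_quotient (hb.spanOmit_ne_top i)

theorem ringKrullDim_quotient_spanOmit_le_one (hb : IsSystemOfParameters b) (i : Fin d) :
    ringKrullDim (A ⧸ spanOmit b i) ≤ 1 := by
  have := hb.isLocalRing_quotient_spanOmit i
  have h1 := ringKrullDim_le_ringKrullDim_quotient_add_card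
    ({Ideal.Quotient.mk (spanOmit b i) (b i)} : Finset _)
    (by
      rw [Finset.coe_singleton, Set.singleton_subset_iff, IsLocalRing.ringJacobson_eq_maximalIdeal]
      exact mk_mem_maximalIdeal_iff.2 (hb.mem_maximalIdeal i))
  rw [Finset.coe_singleton, ringKrullDim_eq_of_ringEquiv (quotientQuotientSpanSingletonEquiv _ _),
    spanOmit_sup_span_singleton, ringKrullDim_quotient_eq_zero_of_radical_eq hb.radical_eq,
    Finset.card_singleton] at h1
  simpa using h1

theorem isGorensteinLocalRing_quotient_spanOmit (hb : IsSystemOfParameters b) (i : Fin d) :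
    IsGorensteinLocalRing (A ⧸ spanOmit b i) := by
  obtain ⟨S, hS, hcard⟩ := exists_finset_coe_eq_image_compl_singleton b i
  rw [spanOmit, ← hS]
  refine IsGorensteinLocalRing.quotient_span_finset S ?_ ?_
  · rw [hS]
    rintro _ ⟨j, -, rfl⟩
    exact hb.mem_maximalIdeal j
  · have h1 := hb.ringKrullDim_quotient_spanOmit_le_one i
    rw [spanOmit, ← hS] at h1
    rw [hb.ringKrullDim_eq]
    refine (add_le_add_left h1 _).trans ?_
    rw [add_comm]
    exact_mod_cast hcard

theorem ringKrullDim_quotient_spanOmit (hb : IsSystemOfParameters b) (i : Fin d) :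
    ringKrullDim (A ⧸ spanOmit b i) = 1 := by
  refine le_antisymm (hb.ringKrullDim_quotient_spanOmit_le_one i) ?_
  obtain ⟨S, hS, hcard⟩ := exists_finset_coe_eq_image_compl_singleton b i
  have := hb.isLocalRing_quotient_spanOmit i
  have h1 := ringKrullDim_le_ringKrullDim_quotient_add_card S (by
    rw [hS, IsLocalRing.ringJacobson_eq_maximalIdeal]
    rintro _ ⟨j, -, rfl⟩
    exact hb.mem_maximalIdeal j)
  rw [hb.ringKrullDim_eq, hS] at h1
  obtain ⟨k, hk⟩ := ringKrullDim_eq_natCast (A ⧸ spanOmit b i)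
  rw [spanOmit] at hk ⊢
  rw [hk] at h1 ⊢
  norm_cast at h1 ⊢
  omega

/-- A member of a system of parameters of a Gorenstein local ring is a nonzerodivisor modulo the
other ones. -/
theorem mk_mem_nonZeroDivisors (hb : IsSystemOfParameters b) (i : Fin d) :
    Ideal.Quotient.mk (spanOmit b i) (b i) ∈ nonZeroDivisors (A ⧸ spanOmit b i) := by
  have := hb.isGorensteinLocalRing_quotient_spanOmit i
  refine IsGorensteinLocalRing.mem_nonZeroDivisors_of_ringKrullDim_lt ?_
  rw [ringKrullDim_eq_of_ringEquiv (quotientQuotientSpanSingletonEquiv _ _),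
    spanOmit_sup_span_singleton, ringKrullDim_quotient_eq_zero_of_radical_eq hb.radical_eq,
    hb.ringKrullDim_quotient_spanOmit i]
  exact zero_lt_one

theorem mem_spanOmit_of_mul_mem (hb : IsSystemOfParameters b) {i : Fin d} {x : A}
    (h : x * b i ∈ spanOmit b i) : x ∈ spanOmit b i := by
  rw [← Ideal.Quotient.eq_zero_iff_mem, map_mul] at h
  exact Ideal.Quotient.eq_zero_iff_mem.1
    ((mul_right_mem_nonZeroDivisors_eq_zero_iff (hb.mk_mem_nonZeroDivisors i)).1 h)

/-- Modulo the other members the ring has dimension one, so a regular z in the maximal ideal cuts it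
down to dimension zero. -/
theorem update (hb : IsSystemOfParameters b) {i : Fin d} {z : A} (hz : z ∈ maximalIdeal A)
    (h0 : Ideal.Quotient.mk (spanOmit b i) z ∈ nonZeroDivisors (A ⧸ spanOmit b i)) :
    IsSystemOfParameters (Function.update b i z) := by
  refine ⟨hb.ringKrullDim_eq, radical_eq_maximalIdeal_of_ringKrullDim_quotient_eq_zero ?_⟩
  have := hb.isLocalRing_quotient_spanOmit i
  have h1 := ringKrullDim_quotient_span_singleton_succ_eq_ringKrullDim_of_mem_nonZeroDivisors
    h0 (mk_mem_maximalIdeal_iff.2 hz)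
  rw [ringKrullDim_eq_of_ringEquiv (quotientQuotientSpanSingletonEquiv _ _),
    ← span_range_update, hb.ringKrullDim_quotient_spanOmit i] at h1
  have : IsLocalRing (A ⧸ Ideal.span (Set.range (Function.update b i z))) := by
    refine isLocalRing_quotient fun h ↦ (maximalIdeal.isMaximal A).ne_top (top_le_iff.1 (h ▸ ?_))
    rw [Ideal.span_le]
    rintro _ ⟨j, rfl⟩
    by_cases hj : j = i
    · subst hj
      simpa using hz
    · simpa [Function.update_of_ne hj] using hb.mem_maximalIdeal j
  obtain ⟨k, hk⟩ := ringKrullDim_eq_natCast (A ⧸ Ideal.span (Set.range (Function.update b i z)))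
  rw [hk] at h1 ⊢
  norm_cast at h1 ⊢
  omega

/-- The quotient of a Gorenstein local ring by a parameter ideal has simple socle. -/
theorem mem_span_singleton_sup (hb : IsSystemOfParameters b) {s t : A}
    (h0 : s ∉ Ideal.span (Set.range b))
    (hs : ∀ y ∈ maximalIdeal A, s * y ∈ Ideal.span (Set.range b))
    (ht : ∀ y ∈ maximalIdeal A, t * y ∈ Ideal.span (Set.range b)) :
    t ∈ Ideal.span {s} ⊔ Ideal.span (Set.range b) := by
  classical
  have hG : IsGorensteinLocalRing (A ⧸ Ideal.span (Set.range b)) := by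
    have hS : ((Finset.univ.image b : Finset A) : Set A) = Set.range b := by simp
    rw [← hS]
    refine IsGorensteinLocalRing.quotient_span_finset _ ?_ ?_
    · rw [hS]
      rintro _ ⟨j, rfl⟩
      exact hb.mem_maximalIdeal j
    · rw [hS, ringKrullDim_quotient_eq_zero_of_radical_eq hb.radical_eq, hb.ringKrullDim_eq,
        zero_add]
      exact_mod_cast Finset.card_image_le.trans (by simp)
  have key (r : A) (hr : ∀ y ∈ maximalIdeal A, r * y ∈ Ideal.span (Set.range b)) :
      ∀ y ∈ maximalIdeal (A ⧸ Ideal.span (Set.range b)),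
        y • Ideal.Quotient.mk (Ideal.span (Set.range b)) r = 0 := by
    intro y hy
    obtain ⟨y, rfl⟩ := Ideal.Quotient.mk_surjective y
    rw [smul_eq_mul, ← map_mul, mul_comm, Ideal.Quotient.eq_zero_iff_mem]
    exact hr y (mk_mem_maximalIdeal_iff.1 hy)
  have h0' : Ideal.Quotient.mk (Ideal.span (Set.range b)) s ≠ 0 := fun h ↦
    h0 (Ideal.Quotient.eq_zero_iff_mem.1 h)
  have := IsGorensteinLocalRing.injective h0' (key s hs)
  have h1 := Module.Injective.mem_span_singleton_of_smul_eq_zero h0' (key s hs) (key t ht)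
  rw [← Set.image_singleton, ← Ideal.map_span, ← Ideal.mem_comap,
    Ideal.comap_map_of_surjective' _ Ideal.Quotient.mk_surjective, Ideal.mk_ker] at h1
  exact h1

/-- There is an element outside of a parameter ideal that is multiplied into it by the maximal
ideal, inside any ideal not contained in the parameter ideal. -/
theorem exists_mem_notMem_mul_mem (hb : IsSystemOfParameters b) {J : Ideal A}
    (hJ : ¬ J ≤ Ideal.span (Set.range b)) :
    ∃ s ∈ J, s ∉ Ideal.span (Set.range b) ∧
      ∀ y ∈ maximalIdeal A, s * y ∈ Ideal.span (Set.range b) := by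
  obtain ⟨n, hn⟩ := Ideal.exists_pow_le_of_le_radical_of_fg hb.radical_eq.ge
    (IsNoetherian.noetherian (maximalIdeal A))
  classical
  -- For the least such n, any element of J𝔪^(n-1) outside the parameter ideal works.
  have hex : ∃ n, J * maximalIdeal A ^ n ≤ Ideal.span (Set.range b) :=
    ⟨n, Ideal.mul_le_right.trans hn⟩
  have h1 := Nat.find_spec hex
  have h2 : Nat.find hex ≠ 0 := fun h ↦ by
    rw [h, pow_zero, mul_one] at h1
    exact hJ h1
  obtain ⟨k, hk⟩ := Nat.exists_eq_succ_of_ne_zero h2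
  have h3 := Nat.find_min hex (hk ▸ Nat.lt_succ_self k)
  obtain ⟨s, hs, hsQ⟩ := Set.not_subset.1 h3
  refine ⟨s, Ideal.mul_le_left hs, hsQ, fun y hy ↦ h1 ?_⟩
  rw [hk, pow_succ, ← mul_assoc]
  exact Ideal.mul_mem_mul hs hy

/-- If the multiplicity is at least three, the socle of the quotient by a parameter ideal is
contained in the square of the maximal ideal. -/
theorem mem_sq_sup_of_mul_mem (hb : IsSystemOfParameters b) (he : 3 ≤ localMultiplicity A) {s : A}
    (hs : ∀ y ∈ maximalIdeal A, s * y ∈ Ideal.span (Set.range b)) :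
    s ∈ maximalIdeal A ^ 2 ⊔ Ideal.span (Set.range b) := by
  set Q := Ideal.span (Set.range b) with hQ
  by_contra hc
  have hsQ : s ∉ Q := fun h ↦ hc (Ideal.mem_sup_right h)
  have hm2 : maximalIdeal A ^ 2 ≤ Q := by
    by_contra hle
    obtain ⟨t, ht, htQ, htm⟩ := hb.exists_mem_notMem_mul_mem hle
    refine hc (sup_le_sup_right ((Ideal.span_singleton_le_iff_mem _).2 ht) _
      (hb.mem_span_singleton_sup htQ htm hs))
  have hm : maximalIdeal A ≤ Ideal.span {s} ⊔ Q := fun t ht ↦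
    hb.mem_span_singleton_sup hsQ hs fun y hy ↦ hm2 (by rw [pow_two]; exact Ideal.mul_mem_mul ht hy)
  -- Now 𝔪 ⊆ (s) + Q: both the image of f and its cokernel are quotients of A/𝔪, so A/Q has length
  -- at most 2.
  let f : (A ⧸ maximalIdeal A) →ₗ[A] A ⧸ Q := residueLift (Submodule.mkQ Q s) fun y hy ↦ by
    rw [← map_smul]
    refine (Submodule.Quotient.mk_eq_zero _).2 ?_
    rw [smul_eq_mul, mul_comm]
    exact hs y hy
  have hmf : maximalIdeal A ≤ (LinearMap.range f).comap Q.mkQ := by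
    intro t ht
    obtain ⟨u, hu, q, hq, rfl⟩ := Submodule.mem_sup.1 (hm ht)
    obtain ⟨r, rfl⟩ := Ideal.mem_span_singleton'.1 hu
    refine ⟨Submodule.mkQ _ r, ?_⟩
    rw [map_add, Submodule.mkQ_apply _ q, (Submodule.Quotient.mk_eq_zero _).2 hq, add_zero]
    exact (map_smul Q.mkQ r s).symm
  have hk : Module.length A (A ⧸ maximalIdeal A) = 1 := by
    rw [Module.length_eq_one_iff, isSimpleModule_iff_isCoatom]
    exact (maximalIdeal.isMaximal A).out
  have h1 := Module.length_eq_add_of_exact (LinearMap.range f).subtype (LinearMap.range f).mkQ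
    (Submodule.subtype_injective _) (Submodule.mkQ_surjective _) (LinearMap.exact_subtype_mkQ _)
  have h2 : Module.length A (LinearMap.range f) ≤ 1 := hk ▸
    Module.length_le_of_surjective f.rangeRestrict f.surjective_rangeRestrict
  have h3 : Module.length A ((A ⧸ Q) ⧸ LinearMap.range f) ≤ 1 := by
    rw [← hk]
    refine Module.length_le_of_surjective
      (Submodule.liftQ (maximalIdeal A) ((LinearMap.range f).mkQ ∘ₗ Q.mkQ) ?_) ?_
    · intro t ht
      exact (Submodule.Quotient.mk_eq_zero _).2 (hmf ht)
    · intro q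
      obtain ⟨q, rfl⟩ := Submodule.mkQ_surjective _ q
      obtain ⟨r, rfl⟩ := Submodule.mkQ_surjective _ q
      exact ⟨Submodule.mkQ _ r, rfl⟩
  have h4 : Module.length A (A ⧸ Q) ≤ 2 := by
    rw [h1]
    exact (add_le_add h2 h3).trans (by norm_num)
  have h5 := he.trans (localMultiplicity_le_length hb.ringKrullDim_eq b hb.mem_maximalIdeal)
  have h6 : ((Module.length A (A ⧸ Q) : ℕ∞) : ℝ≥0∞) ≤ 2 := by
    simpa using ENat.toENNReal_le.2 h4
  exact absurd (h5.trans h6) (by norm_num)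

end IsSystemOfParameters

/-! ### The one-dimensional case. -/

section DimensionOne

variable {R : Type*} [CommRing R] [IsLocalRing R]

/-- Every element becomes a nonzerodivisor after adding a high power of a nonzerodivisor. -/
theorem exists_add_pow_mem_nonZeroDivisors [IsNoetherianRing R] {a : R} (ham : a ∈ maximalIdeal R)
    (ha : a ∈ nonZeroDivisors R) (z : R) : ∃ k : ℕ, z + a ^ (k + 2) ∈ nonZeroDivisors R := by
  by_contra! hc
  have hc' (k : ℕ) : ∃ p ∈ associatedPrimes R R, z + a ^ (k + 2) ∈ p := by
    have : z + a ^ (k + 2) ∈ ⋃ p ∈ associatedPrimes R R, (p : Set R) := by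
      rw [biUnion_associatedPrimes_eq_compl_nonZeroDivisors]
      exact hc k
    simpa using this
  choose p hp hz using hc'
  have hfin := (associatedPrimes.finite R R).to_subtype
  -- Pigeonhole on the finitely many associated primes: two exponents share a prime p, which then
  -- contains a power of a times a unit. Exponents start at 2 to keep the correction in 𝔪².
  obtain ⟨k, l, hkl, heq⟩ := Finite.exists_ne_map_eq_of_infinite
    fun k ↦ (⟨p k, hp k⟩ : associatedPrimes R R)
  wlog hlt : k < l generalizing k l
  · exact this l k hkl.symm heq.symm (lt_of_le_of_ne (not_lt.1 hlt) hkl.symm)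
  have heq' : p k = p l := congrArg Subtype.val heq
  have hpk := IsAssociatedPrime.isPrime (hp k)
  obtain ⟨e, rfl⟩ := Nat.exists_eq_add_of_lt hlt
  have h1 : a ^ (k + 2) * (1 - a ^ (e + 1)) ∈ p k := by
    have := (p k).sub_mem (hz k)
      (show z + a ^ (k + e + 1 + 2) ∈ p k by rw [heq']; exact hz _)
    convert! this using 1
    ring
  rcases hpk.mem_or_mem h1 with h | h
  · exact notMem_of_mem_associatedPrimes (hp k) ha (hpk.mem_of_pow_mem _ h)
  · have h2 : a ^ (e + 1) ∈ maximalIdeal R :=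
      Ideal.pow_mem_of_mem _ ham _ (Nat.succ_pos e)
    have h3 := (maximalIdeal R).add_mem (le_maximalIdeal hpk.ne_top h) h2
    rw [sub_add_cancel] at h3
    exact (maximalIdeal.isMaximal R).ne_top ((Ideal.eq_top_iff_one _).2 h3)

/-- An additive endomorphism of the maximal ideal inducing an endomorphism of the cotangent space
for which all vectors are eigenvectors induces a scalar. -/
theorem exists_forall_sub_mul_mem_sq {w : R → R} {t : R} (ht : t ∈ maximalIdeal R)
    (ht2 : t ∉ maximalIdeal R ^ 2)
    (hadd : ∀ y ∈ maximalIdeal R, ∀ z ∈ maximalIdeal R, w (y + z) = w y + w z)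
    (hmul : ∀ r, ∀ y ∈ maximalIdeal R, w (r * y) = r * w y)
    (hsq : ∀ y ∈ maximalIdeal R ^ 2, w y ∈ maximalIdeal R ^ 2)
    (h : ∀ y ∈ maximalIdeal R, ∃ c, w y - c * y ∈ maximalIdeal R ^ 2) :
    ∃ c, ∀ y ∈ maximalIdeal R, w y - c * y ∈ maximalIdeal R ^ 2 := by
  obtain ⟨c₀, h₀⟩ := h t ht
  refine ⟨c₀, fun z hz ↦ ?_⟩
  obtain ⟨c, hc⟩ := h z hz
  obtain ⟨c', hc'⟩ := h (t + z) (add_mem ht hz)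
  rw [hadd t ht z hz] at hc'
  have h1 : (c' - c₀) * t + (c' - c) * z ∈ maximalIdeal R ^ 2 := by
    have := sub_mem (add_mem h₀ hc) hc'
    convert! this using 1
    ring
  -- If c' - c is a unit, z is a multiple of t modulo 𝔪² and inherits its eigenvalue c₀. Otherwise t
  -- ∉ 𝔪² forces c' - c₀ ∈ 𝔪, so c ≡ c₀ modulo 𝔪.
  by_cases hu : IsUnit (c' - c)
  · obtain ⟨v, hv⟩ := hu.exists_left_inv
    obtain ⟨n, hn, hzn⟩ : ∃ n ∈ maximalIdeal R ^ 2, z = -(v * (c' - c₀)) * t + n := by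
      refine ⟨_, (maximalIdeal R ^ 2).mul_mem_left v h1, ?_⟩
      linear_combination (-z) * hv
    have hw : w z = -(v * (c' - c₀)) * w t + w n := by
      conv_lhs => rw [hzn]
      rw [hadd _ (Ideal.mul_mem_left _ _ ht) _ (Ideal.pow_le_self two_ne_zero hn), hmul _ _ ht]
    have := add_mem (Ideal.mul_mem_left _ (-(v * (c' - c₀))) h₀)
      (sub_mem (hsq n hn) (Ideal.mul_mem_left _ c₀ hn))
    convert! this using 1
    rw [hw]
    conv_lhs => rw [hzn]
    ring
  · have hcc : c' - c ∈ maximalIdeal R := hu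
    have h2 : (c' - c₀) * t ∈ maximalIdeal R ^ 2 := by
      have := sub_mem h1 (pow_two (maximalIdeal R) ▸ Ideal.mul_mem_mul hcc hz)
      simpa using this
    have h3 : c' - c₀ ∈ maximalIdeal R := fun hu' ↦
      ht2 ((Ideal.unit_mul_mem_iff_mem _ hu').1 h2)
    have h4 : (c - c₀) * z ∈ maximalIdeal R ^ 2 := by
      rw [pow_two]
      refine Ideal.mul_mem_mul ?_ hz
      have := sub_mem h3 hcc
      convert! this using 1
      ring
    have := add_mem hc h4
    convert! this using 1
    ring

variable [IsNoetherianRing R] {a : R}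

/-- In a one-dimensional Gorenstein local ring in which the socle of the quotient by every parameter
`z` is contained in `𝔪 ^ 2 + (z)`, the socle of the quotient by `a` has a generator `s` with
`s 𝔪 ⊆ a 𝔪 ^ 2`. -/
theorem exists_mul_eq_mul_mem_sq (ham : a ∈ maximalIdeal R) (ha : a ∈ nonZeroDivisors R)
    (hG : ∀ z ∈ maximalIdeal R, z ∈ nonZeroDivisors R → ∀ s,
      (∀ y ∈ maximalIdeal R, s * y ∈ Ideal.span {z}) → s ∈ maximalIdeal R ^ 2 ⊔ Ideal.span {z})
    {s : R} (hs : ∀ y ∈ maximalIdeal R, s * y ∈ Ideal.span {a}) :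
    ∃ c, ∀ y ∈ maximalIdeal R, ∃ z ∈ maximalIdeal R ^ 2, (s - c * a) * y = a * z := by
  have hcancel {x y : R} (h : a * x = a * y) : x = y :=
    (mul_cancel_left_mem_nonZeroDivisors ha).1 h
  -- Here w is multiplication by s/a on 𝔪; its values outside 𝔪 are irrelevant.
  have hex (y : R) : ∃ w, y ∈ maximalIdeal R → s * y = a * w := by
    by_cases hy : y ∈ maximalIdeal R
    · obtain ⟨w, hw⟩ := Ideal.mem_span_singleton'.1 (hs y hy)
      exact ⟨w, fun _ ↦ by rw [← hw, mul_comm]⟩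
    · exact ⟨0, fun h ↦ absurd h hy⟩
  choose w hw using hex
  have hadd : ∀ y ∈ maximalIdeal R, ∀ z ∈ maximalIdeal R, w (y + z) = w y + w z :=
    fun y hy z hz ↦ hcancel (by
      rw [← hw _ (add_mem hy hz), mul_add, mul_add, hw y hy, hw z hz])
  have hmul : ∀ r, ∀ y ∈ maximalIdeal R, w (r * y) = r * w y := fun r y hy ↦ hcancel (by
    rw [← hw _ (Ideal.mul_mem_left _ _ hy), mul_left_comm, hw y hy, mul_left_comm])
  -- Since w(z)y = w(zy) = z w(y), the element w(z) is in the socle modulo z.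
  have hreg (z : R) (hz : z ∈ maximalIdeal R) (h0 : z ∈ nonZeroDivisors R) :
      ∃ c, w z - c * z ∈ maximalIdeal R ^ 2 := by
    have := hG z hz h0 (w z) fun y hy ↦ Ideal.mem_span_singleton'.2 ⟨w y, by
      rw [mul_comm, ← hmul z y hy, mul_comm z y, hmul y z hz, mul_comm]⟩
    obtain ⟨n, hn, q, hq, hnq⟩ := Submodule.mem_sup.1 this
    obtain ⟨c, rfl⟩ := Ideal.mem_span_singleton'.1 hq
    exact ⟨c, by rw [← hnq, add_sub_cancel_right]; exact hn⟩
  -- Any z becomes regular after adding a regular u ∈ 𝔪², which extends the eigenvector property to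
  -- all of 𝔪.
  have hadj (z : R) (hz : z ∈ maximalIdeal R) : ∃ u ∈ maximalIdeal R ^ 2,
      u ∈ nonZeroDivisors R ∧ z + u ∈ nonZeroDivisors R := by
    obtain ⟨k, hk⟩ := exists_add_pow_mem_nonZeroDivisors ham ha z
    exact ⟨_, Ideal.pow_le_pow_right (Nat.le_add_left 2 k) (Ideal.pow_mem_pow ham _),
      pow_mem ha _, hk⟩
  have hle : maximalIdeal R ^ 2 ≤ maximalIdeal R := Ideal.pow_le_self two_ne_zero
  have hmem' (z : R) (hz : z ∈ maximalIdeal R) (h0 : z ∈ nonZeroDivisors R) :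
      w z ∈ maximalIdeal R := by
    obtain ⟨c, hc⟩ := hreg z hz h0
    have := add_mem (hle hc) (Ideal.mul_mem_left _ c hz)
    rwa [sub_add_cancel] at this
  have hmem (z : R) (hz : z ∈ maximalIdeal R) : w z ∈ maximalIdeal R := by
    obtain ⟨u, hu, hu0, hzu⟩ := hadj z hz
    have h1 := hmem' _ (add_mem hz (hle hu)) hzu
    rw [hadd z hz u (hle hu)] at h1
    exact (Submodule.add_mem_iff_left _ (hmem' u (hle hu) hu0)).1 h1
  have hsq : ∀ y ∈ maximalIdeal R ^ 2, w y ∈ maximalIdeal R ^ 2 := by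
    intro y hy
    rw [pow_two] at hy ⊢
    induction hy using Submodule.mul_induction_on' with
    | mem_mul_mem y hy z hz =>
      rw [hmul y z hz]
      exact Ideal.mul_mem_mul hy (hmem z hz)
    | add y hy z hz hy' hz' =>
      rw [hadd y (Ideal.mul_le_left hy) z (Ideal.mul_le_left hz)]
      exact add_mem hy' hz'
  have hscalar (z : R) (hz : z ∈ maximalIdeal R) : ∃ c, w z - c * z ∈ maximalIdeal R ^ 2 := by
    obtain ⟨u, hu, hu0, hzu⟩ := hadj z hz
    obtain ⟨c, hc⟩ := hreg _ (add_mem hz (hle hu)) hzu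
    refine ⟨c, ?_⟩
    rw [hadd z hz u (hle hu)] at hc
    have := add_mem hc (sub_mem (Ideal.mul_mem_left _ c hu) (hsq u hu))
    convert! this using 1
    ring
  obtain ⟨t, ht, ht2⟩ : ∃ t ∈ maximalIdeal R, t ∉ maximalIdeal R ^ 2 := by
    by_contra! hc
    have hbot : maximalIdeal R = ⊥ := Submodule.eq_bot_of_le_smul_of_le_jacobson_bot
      (maximalIdeal R) _ (IsNoetherian.noetherian _) (fun t ht ↦ by
        have := hc t ht
        rwa [pow_two] at this) (maximalIdeal_le_jacobson _)
    rw [hbot, Ideal.mem_bot] at ham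
    exact nonZeroDivisors.ne_zero ha ham
  obtain ⟨c, hc⟩ := exists_forall_sub_mul_mem_sq ht ht2 hadd hmul hsq hscalar
  refine ⟨c, fun y hy ↦ ⟨_, hc y hy, ?_⟩⟩
  rw [sub_mul, hw y hy]
  ring

/-- In a one-dimensional Gorenstein local ring in which the socle of the quotient by every parameter
`z` is contained in `𝔪 ^ 2 + (z)`, one has `𝔪 ^ 2 ((a) : 𝔪 ^ 2) = a 𝔪 ^ 2`. -/
theorem exists_mem_sq_mul_eq_mul (ham : a ∈ maximalIdeal R) (ha : a ∈ nonZeroDivisors R)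
    (hG : ∀ z ∈ maximalIdeal R, z ∈ nonZeroDivisors R → ∀ s,
      (∀ y ∈ maximalIdeal R, s * y ∈ Ideal.span {z}) → s ∈ maximalIdeal R ^ 2 ⊔ Ideal.span {z})
    {s : R} (hs : ∀ y ∈ maximalIdeal R, s * y ∈ Ideal.span {a})
    (hS : ∀ t, (∀ y ∈ maximalIdeal R, t * y ∈ Ideal.span {a}) →
      t ∈ Ideal.span {s} ⊔ Ideal.span {a})
    {x : R} (hx : ∀ y ∈ maximalIdeal R ^ 2, x * y ∈ Ideal.span {a}) :
    ∀ y ∈ maximalIdeal R ^ 2, ∃ c ∈ maximalIdeal R ^ 2, x * y = c * a := by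
  have hcancel {x y : R} (h : a * x = a * y) : x = y :=
    (mul_cancel_left_mem_nonZeroDivisors ha).1 h
  have hle : maximalIdeal R ^ 2 ≤ maximalIdeal R := Ideal.pow_le_self two_ne_zero
  obtain ⟨c, hc⟩ := exists_mul_eq_mul_mem_sq ham ha hG hs
  have hrep (y : R) (hy : y ∈ maximalIdeal R) : ∃ α β, x * y = α * (s - c * a) + β * a := by
    have := hS (x * y) fun z hz ↦ by
      rw [mul_assoc]
      exact hx _ (pow_two (maximalIdeal R) ▸ Ideal.mul_mem_mul hy hz)
    obtain ⟨p, hp, q, hq, hpq⟩ := Submodule.mem_sup.1 this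
    obtain ⟨α, rfl⟩ := Ideal.mem_span_singleton'.1 hp
    obtain ⟨β, rfl⟩ := Ideal.mem_span_singleton'.1 hq
    exact ⟨α, β + α * c, by rw [← hpq]; ring⟩
  have hmaps {α β y y' : R} (hy : y ∈ maximalIdeal R)
      (hxy : x * y = α * (s - c * a) + β * a) (hy' : y' ∈ maximalIdeal R) :
      ∃ n ∈ maximalIdeal R ^ 2, x * y * y' = a * (n + β * y') := by
    obtain ⟨n, hn, hn'⟩ := hc y' hy'
    refine ⟨α * n, Ideal.mul_mem_left _ _ hn, ?_⟩
    rw [hxy]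
    linear_combination α * hn'
  -- If y generated 𝔪, it would divide a and so be regular, and 1 would be in the socle modulo y,
  -- hence in 𝔪² + (y) ⊆ 𝔪.
  have hprin (y : R) (hy : y ∈ maximalIdeal R) : ¬ maximalIdeal R ≤ Ideal.span {y} := fun h ↦ by
    have hy0 : y ∈ nonZeroDivisors R := by
      obtain ⟨r, rfl⟩ := Ideal.mem_span_singleton'.1 (h ham)
      exact (mul_mem_nonZeroDivisors.1 ha).2
    have h1 := hG y hy hy0 1 fun z hz ↦ by
      rw [one_mul]
      exact h hz
    have h2 := sup_le hle ((Ideal.span_singleton_le_iff_mem _).2 hy) h1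
    exact (maximalIdeal.isMaximal R).ne_top ((Ideal.eq_top_iff_one _).2 h2)
  have hβ {α β y : R} (hy : y ∈ maximalIdeal R) (hxy : x * y = α * (s - c * a) + β * a) :
      β ∈ maximalIdeal R := by
    by_contra hβ
    have hu : IsUnit β := by simpa using hβ
    -- Computing xyp through xy and through xp gives βp ∈ (y) + 𝔪². With β a unit, Nakayama makes 𝔪
    -- principal.
    refine hprin y hy (Submodule.le_of_le_smul_of_le_jacobson_bot (I := maximalIdeal R)
      (IsNoetherian.noetherian _) (maximalIdeal_le_jacobson _) fun p hp ↦ ?_)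
    obtain ⟨α', β', hxp⟩ := hrep p hp
    obtain ⟨n, hn, h1⟩ := hmaps hy hxy hp
    obtain ⟨n', hn', h2⟩ := hmaps hp hxp hy
    have h3 : n + β * p = n' + β' * y := hcancel (by rw [← h1, ← h2]; ring)
    rw [← Ideal.unit_mul_mem_iff_mem _ hu]
    have h4 : β * p = β' * y + (n' - n) := by linear_combination h3
    rw [h4]
    refine Submodule.add_mem_sup (Ideal.mul_mem_left _ _ (Ideal.mem_span_singleton_self y)) ?_
    rw [smul_eq_mul, ← pow_two]
    exact sub_mem hn' hn
  intro y hy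
  rw [pow_two] at hy
  induction hy using Submodule.mul_induction_on' with
  | mem_mul_mem y hy z hz =>
    obtain ⟨α, β, hxy⟩ := hrep y hy
    obtain ⟨n, hn, h1⟩ := hmaps hy hxy hz
    refine ⟨n + β * z, add_mem hn ?_, by rw [← mul_assoc, h1, mul_comm]⟩
    rw [pow_two]
    exact Ideal.mul_mem_mul (hβ hy hxy) hz
  | add y _ z _ hy hz =>
    obtain ⟨c, hc, h1⟩ := hy
    obtain ⟨c', hc', h2⟩ := hz
    exact ⟨c + c', add_mem hc hc', by rw [mul_add, h1, h2, add_mul]⟩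

end DimensionOne

/-! ### From dimension one to arbitrary dimension. -/

section Quotient

variable {A : Type*} [CommRing A] {J : Ideal A}

theorem mk_mem_span_singleton_mk_iff {s z : A} :
    Ideal.Quotient.mk J s ∈ Ideal.span {Ideal.Quotient.mk J z} ↔ s ∈ J ⊔ Ideal.span {z} := by
  rw [← Set.image_singleton, ← Ideal.map_span, ← Ideal.mem_comap,
    Ideal.comap_map_of_surjective' _ Ideal.Quotient.mk_surjective, Ideal.mk_ker, sup_comm]

theorem map_mk_maximalIdeal [IsLocalRing A] [IsLocalRing (A ⧸ J)] :
    (maximalIdeal A).map (Ideal.Quotient.mk J) = maximalIdeal (A ⧸ J) := by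
  ext q
  rw [Ideal.mem_map_iff_of_surjective _ Ideal.Quotient.mk_surjective]
  constructor
  · rintro ⟨a, ha, rfl⟩
    exact mk_mem_maximalIdeal_iff.2 ha
  · intro hq
    obtain ⟨a, rfl⟩ := Ideal.Quotient.mk_surjective q
    exact ⟨a, mk_mem_maximalIdeal_iff.1 hq, rfl⟩

theorem mem_maximalIdeal_sq_quotient_iff [IsLocalRing A] [IsLocalRing (A ⧸ J)] {q : A ⧸ J} :
    q ∈ maximalIdeal (A ⧸ J) ^ 2 ↔
      ∃ a ∈ maximalIdeal A ^ 2, Ideal.Quotient.mk J a = q := by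
  rw [← map_mk_maximalIdeal, ← Ideal.map_pow,
    Ideal.mem_map_iff_of_surjective _ Ideal.Quotient.mk_surjective]

end Quotient

theorem span_range_update_sub {A : Type*} [CommRing A] {d : ℕ} (b : Fin d → A) {i j : Fin d} (hij : i ≠ j) :
    Ideal.span (Set.range (Function.update b j (b j - b i))) = Ideal.span (Set.range b) := by
  rw [span_range_update, ← spanOmit_sup_span_singleton b j]
  have hi := mem_spanOmit b hij
  refine le_antisymm (sup_le le_sup_left ?_) (sup_le le_sup_left ?_)
  · rw [Ideal.span_singleton_le_iff_mem]
    exact sub_mem (Ideal.mem_sup_right (Ideal.mem_span_singleton_self _)) (Ideal.mem_sup_left hi)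
  · rw [Ideal.span_singleton_le_iff_mem]
    have := add_mem (Ideal.mem_sup_right (S := spanOmit b j)
      (Ideal.mem_span_singleton_self (b j - b i))) (Ideal.mem_sup_left hi)
    rwa [sub_add_cancel] at this

namespace IsSystemOfParameters

variable {A : Type u} [CommRing A] [IsGorensteinLocalRing A] {d : ℕ} {b : Fin d → A}

/-- An element of `𝔪 ^ 2 (Q : 𝔪 ^ 2)` lies in `𝔪 ^ 2 b i` modulo the other parameters. -/
theorem exists_sub_mul_mem_spanOmit (hb : IsSystemOfParameters b) (he : 3 ≤ localMultiplicity A)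
    {x : A} (hx : ∀ y ∈ maximalIdeal A ^ 2, x * y ∈ Ideal.span (Set.range b)) (i : Fin d) :
    ∀ y ∈ maximalIdeal A ^ 2, ∃ c ∈ maximalIdeal A ^ 2, x * y - c * b i ∈ spanOmit b i := by
  have hG := hb.isGorensteinLocalRing_quotient_spanOmit i
  have hiff {s : A} : Ideal.Quotient.mk (spanOmit b i) s ∈
      Ideal.span {Ideal.Quotient.mk (spanOmit b i) (b i)} ↔ s ∈ Ideal.span (Set.range b) := by
    rw [mk_mem_span_singleton_mk_iff, spanOmit_sup_span_singleton]
  obtain ⟨s, -, hsQ, hs⟩ := hb.exists_mem_notMem_mul_mem (J := ⊤)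
    fun h ↦ hb.span_ne_top (top_le_iff.1 h)
  intro y hy
  obtain ⟨c, hc, h⟩ := exists_mem_sq_mul_eq_mul (a := Ideal.Quotient.mk (spanOmit b i) (b i))
    (s := Ideal.Quotient.mk _ s) (x := Ideal.Quotient.mk _ x)
    (mk_mem_maximalIdeal_iff.2 (hb.mem_maximalIdeal i)) (hb.mk_mem_nonZeroDivisors i)
    -- A regular z modulo the other parameters can replace b i, so the multiplicity bound on socles
    -- applies to the new system as well.
    (by
      intro z hz hz0 t ht
      obtain ⟨z, rfl⟩ := Ideal.Quotient.mk_surjective z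
      obtain ⟨t, rfl⟩ := Ideal.Quotient.mk_surjective t
      have h1 := (hb.update (mk_mem_maximalIdeal_iff.1 hz) hz0).mem_sq_sup_of_mul_mem he
        (s := t) fun y hy ↦ by
          rw [span_range_update, ← mk_mem_span_singleton_mk_iff, map_mul]
          exact ht _ (mk_mem_maximalIdeal_iff.2 hy)
      obtain ⟨n, hn, q, hq, rfl⟩ := Submodule.mem_sup.1 h1
      rw [map_add]
      refine Submodule.add_mem_sup (mem_maximalIdeal_sq_quotient_iff.2 ⟨n, hn, rfl⟩) ?_
      rwa [mk_mem_span_singleton_mk_iff, ← span_range_update])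
    (by
      intro y hy
      obtain ⟨y, rfl⟩ := Ideal.Quotient.mk_surjective y
      rw [← map_mul, hiff]
      exact hs y (mk_mem_maximalIdeal_iff.1 hy))
    (by
      intro t ht
      obtain ⟨t, rfl⟩ := Ideal.Quotient.mk_surjective t
      have h1 := hb.mem_span_singleton_sup hsQ hs (t := t) fun y hy ↦ by
        rw [← hiff, map_mul]
        exact ht _ (mk_mem_maximalIdeal_iff.2 hy)
      obtain ⟨n, hn, q, hq, rfl⟩ := Submodule.mem_sup.1 h1
      rw [map_add]
      refine Submodule.add_mem_sup ?_ (hiff.2 hq)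
      rw [mk_mem_span_singleton_mk_iff]
      exact Ideal.mem_sup_right hn)
    (by
      intro y hy
      obtain ⟨z, hz, rfl⟩ := mem_maximalIdeal_sq_quotient_iff.1 hy
      rw [← map_mul, hiff]
      exact hx z hz)
    (Ideal.Quotient.mk _ y) (mem_maximalIdeal_sq_quotient_iff.2 ⟨y, hy, rfl⟩)
  obtain ⟨e, he, rfl⟩ := mem_maximalIdeal_sq_quotient_iff.1 hc
  refine ⟨e, he, ?_⟩
  rwa [← Ideal.Quotient.eq_zero_iff_mem, map_sub, map_mul, map_mul, sub_eq_zero]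

/-- The pairs of indices in increasing order. -/
abbrev IncreasingPair (d : ℕ) := {t : Fin d × Fin d // t.1 < t.2}

/-- An element lying in `𝔪 ^ 2 b i` modulo the other parameters, for all `i`, lies in `𝔪 ^ 2 Q` up
to a combination of squarefree monomials of degree two. -/
theorem mem_sq_mul_sup_of_forall (hb : IsSystemOfParameters b) {p : A}
    (hp : p ∈ Ideal.span (Set.range b))
    (h : ∀ i, ∃ c ∈ maximalIdeal A ^ 2, p - c * b i ∈ spanOmit b i) :
    p ∈ maximalIdeal A ^ 2 * Ideal.span (Set.range b) ⊔
      Ideal.span (Set.range fun t : IncreasingPair d ↦ b t.1.1 * b t.1.2) := by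
  set K := Ideal.span (Set.range fun t : IncreasingPair d ↦ b t.1.1 * b t.1.2) with hK
  have hKmem {i j : Fin d} (hij : i ≠ j) : b i * b j ∈ K := by
    rcases lt_or_gt_of_ne hij with hlt | hlt
    · exact Ideal.subset_span ⟨⟨(i, j), hlt⟩, rfl⟩
    · rw [mul_comm]
      exact Ideal.subset_span ⟨⟨(j, i), hlt⟩, rfl⟩
  have hKomit (i : Fin d) {g : A} (hg : g ∈ spanOmit b i) : g * b i ∈ K := by
    rw [spanOmit] at hg
    induction hg using Submodule.span_induction with
    | mem x hx =>
      obtain ⟨j, hj, rfl⟩ := hx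
      exact hKmem hj
    | zero => simp
    | add x y _ _ hx hy =>
      rw [add_mul]
      exact add_mem hx hy
    | smul r x _ hx =>
      rw [smul_eq_mul, mul_assoc]
      exact Ideal.mul_mem_left _ _ hx
  obtain ⟨e, rfl⟩ := Ideal.mem_span_range_iff_exists_fun.1 hp
  refine Submodule.sum_mem _ fun i _ ↦ ?_
  obtain ⟨c, hc, h1⟩ := h i
  have h2 : (e i - c) * b i ∈ spanOmit b i := by
    rw [← Finset.add_sum_erase _ _ (Finset.mem_univ i)] at h1
    have h3 : ∑ j ∈ Finset.univ.erase i, e j * b j ∈ spanOmit b i :=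
      Submodule.sum_mem _ fun j hj ↦
        Ideal.mul_mem_left _ _ (mem_spanOmit b (Finset.ne_of_mem_erase hj))
    have := sub_mem h1 h3
    convert! this using 1
    ring
  -- Since b i is regular modulo the others, e i - c is a combination of them, and its product with
  -- b i is one of squarefree monomials.
  have h3 := hb.mem_spanOmit_of_mul_mem h2
  have h4 : e i * b i = c * b i + (e i - c) * b i := by ring
  rw [h4]
  exact Submodule.add_mem_sup (Ideal.mul_mem_mul hc (Ideal.subset_span ⟨i, rfl⟩)) (hKomit i h3)

/-- A system of parameters generating the same ideal and having as many members as possible in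
`𝔪 ^ 2`. -/
theorem exists_minimal (hb : IsSystemOfParameters b) :
    ∃ b' : Fin d → A, IsSystemOfParameters b' ∧
      Ideal.span (Set.range b') = Ideal.span (Set.range b) ∧
      ∀ b'' : Fin d → A, Ideal.span (Set.range b'') = Ideal.span (Set.range b) →
        ¬ {i | b'' i ∉ maximalIdeal A ^ 2} ⊂ {i | b' i ∉ maximalIdeal A ^ 2} := by
  let S : Set (Fin d → A) := {b' | Ideal.span (Set.range b') = Ideal.span (Set.range b)}
  obtain ⟨b', hb', hmin⟩ := (measure fun b' : Fin d → A ↦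
    {i | b' i ∉ maximalIdeal A ^ 2}.ncard).wf.has_min S ⟨b, rfl⟩
  refine ⟨b', ⟨hb.ringKrullDim_eq, ?_⟩, hb', fun b'' hb'' hlt ↦ hmin b'' hb'' ?_⟩
  · rw [show Ideal.span (Set.range b') = Ideal.span (Set.range b) from hb', hb.radical_eq]
  · exact Set.ncard_lt_ncard hlt (Set.toFinite _)

/-- The coefficient of the squarefree monomial `b i * b j` is not a unit, if `b` has as many members
as possible in `𝔪 ^ 2`, and none of `b i` and `b j` is one of them. -/
theorem coeff_mem_maximalIdeal (hb : IsSystemOfParameters b)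
    (hmin : ∀ b' : Fin d → A, Ideal.span (Set.range b') = Ideal.span (Set.range b) →
      ¬ {i | b' i ∉ maximalIdeal A ^ 2} ⊂ {i | b i ∉ maximalIdeal A ^ 2})
    {i j : Fin d} (hij : i < j) (hi : b i ∉ maximalIdeal A ^ 2) (hj : b j ∉ maximalIdeal A ^ 2)
    {q : A} (hq : q ∈ maximalIdeal A ^ 2 * Ideal.span (Set.range b)) (r : IncreasingPair d → A)
    {c : A} (hc : c ∈ maximalIdeal A ^ 2)
    (h : q + ∑ t, r t * (b t.1.1 * b t.1.2) - c * b i ∈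
      spanOmit (Function.update b j (b j - b i)) i) :
    r ⟨(i, j), hij⟩ ∈ maximalIdeal A := by
  set b' := Function.update b j (b j - b i) with hb'def
  set J := spanOmit b' i with hJ
  have hspan : Ideal.span (Set.range b') = Ideal.span (Set.range b) :=
    span_range_update_sub b hij.ne
  have hb' : IsSystemOfParameters b' := ⟨hb.ringKrullDim_eq, by rw [hspan, hb.radical_eq]⟩
  have hbi : b' i = b i := Function.update_of_ne hij.ne _ _
  have hbj : b j - b i ∈ J := by
    have := mem_spanOmit b' hij.ne'
    rwa [hb'def, Function.update_self] at this
  have hbl (l : Fin d) (hli : l ≠ i) (hlj : l ≠ j) : b l ∈ J := by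
    have := mem_spanOmit b' hli
    rwa [hb'def, Function.update_of_ne hlj] at this
  have hsup : J ⊔ Ideal.span {b i} = Ideal.span (Set.range b) := by
    rw [← hspan, ← spanOmit_sup_span_singleton b' i, hbi]
  -- Modulo J every b l with l ≠ i, j vanishes and b j ≡ b i. Thus q becomes μ b i, and the monomial
  -- sum becomes r (b i)².
  obtain ⟨μ, hμ, hqμ⟩ : ∃ μ ∈ maximalIdeal A ^ 2, q - μ * b i ∈ J := by
    rw [← hsup, Ideal.mul_sup] at hq
    obtain ⟨q₁, h₁, q₂, h₂, rfl⟩ := Submodule.mem_sup.1 hq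
    obtain ⟨μ, hμ, rfl⟩ := Ideal.mem_mul_span_singleton.1 h₂
    refine ⟨μ, hμ, ?_⟩
    rw [add_sub_cancel_right]
    exact Ideal.mul_le_right h₁
  have hsum : ∑ t, r t * (b t.1.1 * b t.1.2) - r ⟨(i, j), hij⟩ * (b i * b j) ∈ J := by
    rw [← Finset.add_sum_erase _ _ (Finset.mem_univ (⟨(i, j), hij⟩ : IncreasingPair d)),
      add_sub_cancel_left]
    refine Submodule.sum_mem _ ?_
    rintro ⟨⟨k, l⟩, hkl⟩ ht
    refine Ideal.mul_mem_left _ _ ?_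
    have hne : ¬ (k = i ∧ l = j) := fun h ↦ Finset.ne_of_mem_erase ht (by
      obtain ⟨rfl, rfl⟩ := h
      rfl)
    change k < l at hkl
    change b k * b l ∈ J
    by_cases hk : k ≠ i ∧ k ≠ j
    · exact Ideal.mul_mem_right _ _ (hbl k hk.1 hk.2)
    · refine Ideal.mul_mem_left _ _ (hbl l ?_ ?_)
      · rintro rfl
        exact hk ⟨hkl.ne, (hkl.trans hij).ne⟩
      · rintro rfl
        exact hk ⟨fun h ↦ hne ⟨h, rfl⟩, hkl.ne⟩
  have h1 : (r ⟨(i, j), hij⟩ * b i + μ - c) * b' i ∈ J := by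
    rw [hbi]
    have := sub_mem (sub_mem (sub_mem h hqμ) hsum)
      (Ideal.mul_mem_left _ (r ⟨(i, j), hij⟩ * b i) hbj)
    convert! this using 1
    ring
  have h2 := hb'.mem_spanOmit_of_mul_mem h1
  by_contra hr
  have hu : IsUnit (r ⟨(i, j), hij⟩) := by simpa using hr
  obtain ⟨v, hv⟩ := hu.exists_left_inv
  -- After cancelling b i, a unit r would give b i ≡ n modulo J with n ∈ 𝔪², so n could replace b i
  -- without changing the ideal.
  have hn : b i - v * (r ⟨(i, j), hij⟩ * b i + μ - c) ∈ maximalIdeal A ^ 2 := by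
    have := Ideal.mul_mem_left _ v (sub_mem hc hμ)
    convert! this using 1
    linear_combination (-b i) * hv
  set n := b i - v * (r ⟨(i, j), hij⟩ * b i + μ - c) with hndef
  have hg : v * (r ⟨(i, j), hij⟩ * b i + μ - c) ∈ J := Ideal.mul_mem_left _ v h2
  have hspan' : Ideal.span (Set.range (Function.update b' i n)) = Ideal.span (Set.range b) := by
    rw [span_range_update, ← hJ, ← hsup]
    refine le_antisymm (sup_le le_sup_left ?_) (sup_le le_sup_left ?_)
    · rw [Ideal.span_singleton_le_iff_mem]
      exact sub_mem (Ideal.mem_sup_right (Ideal.mem_span_singleton_self _)) (Ideal.mem_sup_left hg)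
    · rw [Ideal.span_singleton_le_iff_mem]
      have := add_mem (Ideal.mem_sup_right (S := J) (Ideal.mem_span_singleton_self n))
        (Ideal.mem_sup_left hg)
      rwa [hndef, sub_add_cancel] at this
  -- Index i leaves the set; j already belonged to it, so having changed b j costs nothing.
  refine hmin _ hspan' ⟨fun l hl ↦ ?_, fun hsub ↦ hsub hi ?_⟩
  · rw [Set.mem_ofPred_eq] at hl ⊢
    by_cases hli : l = i
    · rwa [hli]
    · rw [Function.update_of_ne hli] at hl
      by_cases hlj : l = j
      · rwa [hlj]
      · rwa [hb'def, Function.update_of_ne hlj] at hl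
  · rwa [Function.update_self]

/-- If the multiplicity is at least three, then `𝔪 ^ 2 (Q : 𝔪 ^ 2) ⊆ 𝔪 ^ 2 Q` for any parameter
ideal `Q` of a Gorenstein local ring. -/
theorem mul_mem_sq_mul_span (hb : IsSystemOfParameters b) (he : 3 ≤ localMultiplicity A) {x : A}
    (hx : ∀ y ∈ maximalIdeal A ^ 2, x * y ∈ Ideal.span (Set.range b)) {y : A}
    (hy : y ∈ maximalIdeal A ^ 2) :
    x * y ∈ maximalIdeal A ^ 2 * Ideal.span (Set.range b) := by
  obtain ⟨b', hb', hspan, hmin⟩ := hb.exists_minimal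
  rw [← hspan] at hx hmin ⊢
  clear hspan hb
  obtain ⟨q, hq, k, hk, hqk⟩ := Submodule.mem_sup.1 (hb'.mem_sq_mul_sup_of_forall (hx y hy)
    fun i ↦ hb'.exists_sub_mul_mem_spanOmit he hx i y hy)
  rw [← hqk]
  refine add_mem hq ?_
  obtain ⟨r, rfl⟩ := Ideal.mem_span_range_iff_exists_fun.1 hk
  refine Submodule.sum_mem _ ?_
  rintro ⟨⟨i, j⟩, hij⟩ -
  change i < j at hij
  change r ⟨(i, j), hij⟩ * (b' i * b' j) ∈ _
  have hmem (l : Fin d) : b' l ∈ Ideal.span (Set.range b') := Ideal.subset_span ⟨l, rfl⟩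
  by_cases hi : b' i ∈ maximalIdeal A ^ 2
  · exact Ideal.mul_mem_left _ _ (Ideal.mul_mem_mul hi (hmem j))
  by_cases hj : b' j ∈ maximalIdeal A ^ 2
  · rw [mul_comm (b' i)]
    exact Ideal.mul_mem_left _ _ (Ideal.mul_mem_mul hj (hmem i))
  -- The modified system generates the same Q, so the hypothesis on x applies to it unchanged.
  have hspan := span_range_update_sub b' hij.ne
  have hb'' : IsSystemOfParameters (Function.update b' j (b' j - b' i)) :=
    ⟨hb'.ringKrullDim_eq, by rw [hspan, hb'.radical_eq]⟩
  obtain ⟨c, hc, h⟩ := hb''.exists_sub_mul_mem_spanOmit he (x := x) (by rwa [hspan]) i y hy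
  rw [Function.update_of_ne hij.ne, ← hqk] at h
  have hr := hb'.coeff_mem_maximalIdeal hmin hij hi hj hq r hc h
  rw [← mul_assoc]
  refine Ideal.mul_mem_mul ?_ (hmem j)
  rw [pow_two]
  exact Ideal.mul_mem_mul hr (hb'.mem_maximalIdeal i)

end IsSystemOfParameters

/-! ### The determinant trick and the conclusion. -/

/-- The determinant trick: an element multiplying a finitely generated ideal `M` containing a
nonzerodivisor into `Q M` is integral over `Q`. -/
theorem IsIntegralOverIdeal.of_forall_mul_mem {A : Type*} [CommRing A] [Nontrivial A]
    {Q M : Ideal A} (hM : M.FG) {a : A} (haM : a ∈ M) (ha : a ∈ nonZeroDivisors A) {x : A}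
    (hx : ∀ y ∈ M, x * y ∈ M * Q) : IsIntegralOverIdeal Q x := by
  have : Module.Finite A M := Module.Finite.iff_fg.2 hM
  let f : Module.End A M := LinearMap.lsmul A M x
  have hf : LinearMap.range f ≤ Q • ⊤ := by
    rintro _ ⟨y, rfl⟩
    have h1 : ((f y : M) : A) ∈ Submodule.map M.subtype (Q • ⊤) := by
      rw [Submodule.map_smul'', Submodule.map_top, Submodule.range_subtype, smul_eq_mul, mul_comm]
      exact hx y y.2
    obtain ⟨z, hz, hzy⟩ := h1
    rwa [← Subtype.ext hzy]
  obtain ⟨p, hp, -, hcoeff, hpf⟩ :=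
    LinearMap.exists_monic_and_natDegree_eq_and_coeff_mem_pow_and_aeval_eq_zero A f Q hf
  have haeval (q : Polynomial A) (y : M) : ((Polynomial.aeval f q y : M) : A) = q.eval x * y := by
    induction q using Polynomial.induction_on' with
    | add q r hq hr => simp [hq, hr, add_mul]
    | monomial n c =>
      have hpow (n : ℕ) (y : M) : (((f ^ n) y : M) : A) = x ^ n * y := by
        induction n with
        | zero => simp
        | succ n ih =>
          rw [pow_succ', Module.End.mul_apply, pow_succ', mul_assoc, ← ih]
          rfl
      simp [Polynomial.aeval_monomial, hpow, mul_assoc]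
  -- By Cayley–Hamilton p(x) kills M, and M contains a nonzerodivisor.
  have hroot : p.eval x = 0 := by
    have h1 := haeval p ⟨a, haM⟩
    rw [hpf] at h1
    exact (mul_right_mem_nonZeroDivisors_eq_zero_iff ha).1 h1.symm
  -- c i is the coefficient of X^(deg p - i). Degree zero is impossible: p would be 1, which has no
  -- root.
  refine ⟨p.natDegree, fun i ↦ p.coeff (p.natDegree - i), ?_, fun i hi ↦ ?_, ?_⟩
  · by_contra! hdeg
    rw [Polynomial.eq_one_of_monic_natDegree_zero hp (by omega), Polynomial.eval_one] at hroot
    exact one_ne_zero hroot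
  · have := hcoeff (p.natDegree - i)
    rwa [Nat.sub_sub_self (Finset.mem_Icc.1 hi).2] at this
  · rw [← hroot, Polynomial.eval_eq_sum_range, Finset.sum_range_succ, hp.coeff_natDegree, one_mul,
      add_comm]
    congr 1
    refine Finset.sum_bij' (fun i _ ↦ p.natDegree - i) (fun i _ ↦ p.natDegree - i) ?_ ?_ ?_ ?_ ?_
    · intro i hi
      rw [Finset.mem_Icc] at hi
      rw [Finset.mem_range]
      omega
    · intro i hi
      rw [Finset.mem_range] at hi
      rw [Finset.mem_Icc]
      omega
    · intro i hi
      exact Nat.sub_sub_self (Finset.mem_Icc.1 hi).2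
    · intro i hi
      exact Nat.sub_sub_self (Finset.mem_range.1 hi).le
    · intro i _
      rfl

end

theorem corollary2p8 {A : Type*} [CommRing A] [IsGorensteinLocalRing A]
    (hdim : 0 < ringKrullDim A)
    (he : 3 ≤ localMultiplicity A)
    (Q : Ideal A) (hQ : IsParameterIdeal Q)
    (hv : haveI := hQ.isLocalRing_quotient; 1 < embeddingDimension (A ⧸ Q)) :
    ∀ x ∈ Q.colon ((IsLocalRing.maximalIdeal A ^ 2 : Ideal A) : Set A),
      IsIntegralOverIdeal Q x := by
  obtain ⟨d, b, hd, rfl, hrad⟩ := hQ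
  have hb : IsSystemOfParameters b := ⟨hd, hrad⟩
  -- If 𝔪 were associated, unmixedness would give dim A ≤ dim A/𝔪 = 0.
  have hm : IsLocalRing.maximalIdeal A ∉ associatedPrimes A A := fun hm ↦ by
    have h1 := IsGorensteinLocalRing.ringKrullDim_le_of_mem_associatedPrimes hm
    have h2 : ringKrullDim (A ⧸ IsLocalRing.maximalIdeal A) = 0 :=
      ringKrullDim_quotient_eq_zero_of_radical_eq (Ideal.IsPrime.radical inferInstance)
    rw [h2] at h1
    exact absurd hdim h1.not_gt
  obtain ⟨a, ham, ha⟩ := exists_mem_maximalIdeal_mem_nonZeroDivisors hm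
  intro x hx
  have hx' : ∀ y ∈ IsLocalRing.maximalIdeal A ^ 2, x * y ∈ Ideal.span (Set.range b) :=
    fun y hy ↦ by simpa using Submodule.mem_colon.1 hx y hy
  exact .of_forall_mul_mem (IsNoetherian.noetherian _) (Ideal.pow_mem_pow ham 2) (pow_mem ha 2)
    fun y hy ↦ hb.mul_mem_sq_mul_span he hx' hy
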